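/- A bipartite (Tanner) graph $\mathcal G=(V,W,E)$ has a finite set $V$ of bit nodes and a finite set $W$ of check nodes; its transpose is $\mathcal G^T=(W,V,E)$, and its parity-check matrix is the binary matrix $H$ with rows indexed by $W$, columns indexed by $V$ and $H_{w,v}=1$ iff $v$ and $w$ are adjacent. $\mathcal G$ is \emph{$(r,t,s)$-exact} if every $v\in V$ has $t$ neighbours, every $w\in W$ has $r+1$ neighbours, any two distinct check nodes have $0$ or exactly $s+1$ common neighbours, and any three distinct check nodes have $0$ or exactly $1$ common neighbour. The product $\mathcal G_1\boxtimes\mathcal G_2$ has bit nodes $V_1\times V_2\,\cup\,W_1\times W_2$ and check nodes $W_1\times V_2\,\cup\,V_1\times W_2$; two nodes are adjacent iff they agree in one coordinate and are adjacent in the other. For $i=1,2$ let $r_i$ be odd, let $t_i\ge 2$ be even, and let $\mathcal G_i=(V_i,W_i,E_i)$ be an $(r_i,t_i,1)$-exact Tanner graph whose transpose $\mathcal G_i^T$ is $(t_i-1,r_i+1,1)$-exact. Let $n_i,k_i,d_i$ (respectively $n_i^T,k_i^T,d_i^T$) be the length, dimension and minimum distance of the binary linear code whose parity-check matrix has Tanner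 graph $\mathcal G_i$ (respectively $\mathcal G_i^T$). Let $H$ be the parity-check matrix of $\mathcal G_1\boxtimes\mathcal G_2$. Then $HH^T=0$ over $\mathbb F_2$, so that $H_X=H_Z=H$ defines a CSS code $Q(\mathcal G_1\boxtimes\mathcal G_2)$, the joint $+1$ eigenspace of the operators $X^h,Z^h$ for $h$ a row of $H$. It is an $[[n,k,d]]$ quantum code (that is, on $n$ qubits, of dimension $2^k$ and distance $d$, with $d=\infty$ if $k=0$), where 1. $n=|W_1||W_2|+|V_1||V_2|$; 2. $k\ge(2k_1-n_1)(2k_2-n_2)+(2k_1^T-n_1^T)(2k_2^T-n_2^T)$; 3. $d\ge\min\{d_1,d_2,d_1^T,d_2^T\}$; 4. if $t_i=r_i+1$ for $i=1,2$, then $Q(\mathcal G_1\boxtimes\mathcal G_2)$ is an exact $(r,t,1)$-qLRC with $r=r_1+r_2+1$ and $t=r_1+r_2+2$. That is, there are sets of qubits $\Gamma_l(j)$ for every qubit $j$ and $1\le l\le t$ such that $j\in\Gamma_l(j)$, $|\Gamma_l(j)|=r+1$, $|\Gamma_{l_1}(j)\cap\Gamma_{l_2}(j)|=2$ and $\Gamma_{l_1}(j)\cap\Gamma_{l_2}(j)\cap\Gamma_{l_3}(j)=\{j\}$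 for distinct $l_1,l_2,l_3$, and for every $j$ and $l$ there is a quantum channel $\mathrm{Rec}_{l,j}$ supported on the qubits in $\Gamma_l(j)$ with $\mathrm{Rec}_{l,j}(\mathrm{Tr}_j(\psi))=\psi$ for every code state $\psi$, where the erased qubit $j$ is replaced by a maximally mixed one. -/

import Mathlib

open scoped Matrix

/-! ### Bipartite (Tanner) graphs -/

/-- A bipartite graph with bit nodes `V` and check nodes `W`. -/
structure TannerGraph (V W : Type*) where
  /-- `Adj v w` : the bit node `v` and the check node `w` are joined by an edge. -/
  Adj : V → W → Prop

namespace TannerGraph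

/-- The transpose: bit nodes and check nodes are exchanged. -/
def transpose {V W : Type*} (G : TannerGraph V W) : TannerGraph W V where
  Adj w v := G.Adj v w

/-- The product of two bipartite graphs. Its bit nodes are `V₁ × V₂ ∪ W₁ × W₂`, its check nodes are
`W₁ × V₂ ∪ V₁ × W₂`, and two nodes are joined iff they agree in one coordinate and are joined
in the other one. -/
def prod {V₁ W₁ V₂ W₂ : Type*} (G₁ : TannerGraph V₁ W₁) (G₂ : TannerGraph V₂ W₂) :
    TannerGraph ((V₁ × V₂) ⊕ (W₁ × W₂)) ((W₁ × V₂) ⊕ (V₁ × W₂)) where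
  Adj
    | .inl (v₁, v₂), .inl (w₁, u₂) => v₂ = u₂ ∧ G₁.Adj v₁ w₁
    | .inl (v₁, v₂), .inr (u₁, w₂) => v₁ = u₁ ∧ G₂.Adj v₂ w₂
    | .inr (w₁, w₂), .inl (u₁, v₂) => w₁ = u₁ ∧ G₂.Adj v₂ w₂
    | .inr (w₁, w₂), .inr (v₁, u₂) => w₂ = u₂ ∧ G₁.Adj v₁ w₁

open Classical in
/-- The binary parity-check matrix whose Tanner graph is `G`: rows are check nodes, columns are
bit nodes. -/
noncomputable def parityCheck {V W : Type*} (G : TannerGraph V W) : Matrix W V (ZMod 2) :=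
  Matrix.of fun w v => if G.Adj v w then 1 else 0

open Classical in
/-- `(r, t, s)`-exact bipartite graphs. -/
structure IsExact {V W : Type*} [Fintype V] [Fintype W] (G : TannerGraph V W) (r t s : ℕ) :
    Prop where
  bit_degree : ∀ v, (Finset.univ.filter fun w => G.Adj v w).card = t
  check_degree : ∀ w, (Finset.univ.filter fun v => G.Adj v w).card = r + 1
  two_checks : ∀ w w', w ≠ w' →
    (Finset.univ.filter fun v => G.Adj v w ∧ G.Adj v w').card = 0 ∨
    (Finset.univ.filter fun v => G.Adj v w ∧ G.Adj v w').card = s + 1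
  three_checks : ∀ w w' w'', w ≠ w' → w ≠ w'' → w' ≠ w'' →
    (Finset.univ.filter fun v => G.Adj v w ∧ G.Adj v w' ∧ G.Adj v w'').card = 0 ∨
    (Finset.univ.filter fun v => G.Adj v w ∧ G.Adj v w' ∧ G.Adj v w'').card = 1

/-- The binary linear code with parity-check matrix `G.parityCheck`. -/
noncomputable def code {V W : Type*} [Fintype V] (G : TannerGraph V W) :
    Submodule (ZMod 2) (V → ZMod 2) :=
  LinearMap.ker G.parityCheck.mulVecLin

end TannerGraph

/-! ### Binary linear codes -/

/-- The minimum distance of a binary linear code (`⊤` if there is only one codeword). -/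
noncomputable def minDistance {V : Type*} [Fintype V] (C : Submodule (ZMod 2) (V → ZMod 2)) : ℕ∞ :=
  ⨅ (c : V → ZMod 2) (c' : V → ZMod 2) (_ : c ∈ C) (_ : c' ∈ C) (_ : c ≠ c'),
    (hammingDist c c' : ℕ∞)

/-- `C` is a binary linear code of length `n`, dimension `k` and minimum distance `d`. -/
structure IsLinearCode {V : Type*} [Fintype V] (C : Submodule (ZMod 2) (V → ZMod 2))
    (n k : ℕ) (d : ℕ∞) : Prop where
  length : Fintype.card V = n
  dimension : Module.finrank (ZMod 2) C = k
  distance : minDistance C = d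

/-! ### Qubits, Pauli operators, quantum codes

The computational basis of `(ℂ²)^{⊗ Q}` is indexed by `Q → ZMod 2`; a vector is a function
`(Q → ZMod 2) → ℂ`, and an operator is a matrix. -/

/-- Labels of the computational basis of a register of qubits indexed by `Q`. -/
abbrev QBasis (Q : Type*) := Q → ZMod 2

/-- Vectors of `(ℂ²)^{⊗ Q}`. -/
abbrev QVec (Q : Type*) := QBasis Q → ℂ

/-- Linear operators on `(ℂ²)^{⊗ Q}`. -/
abbrev QOp (Q : Type*) := Matrix (QBasis Q) (QBasis Q) ℂ

section Quantum

variable {Q : Type*} [Fintype Q] [DecidableEq Q]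

/-- The Pauli operator `X^a : |y⟩ ↦ |y + a⟩`. -/
def pauliX (a : QBasis Q) : QOp Q :=
  Matrix.of fun x y => if x = y + a then 1 else 0

/-- The Pauli operator `Z^b : |y⟩ ↦ (-1)^{b · y} |y⟩`. -/
def pauliZ (b : QBasis Q) : QOp Q :=
  Matrix.diagonal fun y => (-1 : ℂ) ^ (b ⬝ᵥ y).val

/-- The joint `+1` eigenspace of a set of operators. -/
def stabilizedSpace (G : Set (QOp Q)) : Submodule ℂ (QVec Q) where
  carrier := {ψ | ∀ g ∈ G, g *ᵥ ψ = ψ}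
  add_mem' := by
    intro ψ φ hψ hφ g hg
    rw [Matrix.mulVec_add, hψ g hg, hφ g hg]
  zero_mem' := by
    intro g _
    exact Matrix.mulVec_zero g
  smul_mem' := by
    intro c ψ hψ g hg
    rw [Matrix.mulVec_smul, hψ g hg]

/-- The stabilizer group of `CSS(H_X, H_Z)`, generated by `X^h`, `h` a row of `H_X`, and `Z^h`,
`h` a row of `H_Z`. (The generators are involutions, so the monoid they generate is a group.) -/
def cssStabilizer {WX WZ : Type*} (HX : Matrix WX Q (ZMod 2)) (HZ : Matrix WZ Q (ZMod 2)) :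
    Submonoid (QOp Q) :=
  Submonoid.closure (Set.range (fun w => pauliX (HX w)) ∪ Set.range (fun w => pauliZ (HZ w)))

/-- The code space of `CSS(H_X, H_Z)`; it is a CSS code when `H_X * H_Zᵀ = 0`. -/
def cssCode {WX WZ : Type*} (HX : Matrix WX Q (ZMod 2)) (HZ : Matrix WZ Q (ZMod 2)) :
    Submodule ℂ (QVec Q) :=
  stabilizedSpace (cssStabilizer HX HZ : Set (QOp Q))

/-- `A` acts only on the qubits in `S`: it is `L ⊗ 1` for an operator `L` on the qubits in `S`. -/
def SupportedOn (S : Finset Q) (A : QOp Q) : Prop :=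
  ∃ L : QOp S, ∀ x y : QBasis Q,
    A x y = if ∀ i, i ∉ S → x i = y i then L (fun i => x i) (fun i => y i) else 0

/-- The error `E` is detectable by the code `C` (Knill–Laflamme): the compression of `E` to `C`
is a scalar. -/
def IsDetectable (C : Submodule ℂ (QVec Q)) (E : QOp Q) : Prop :=
  ∃ c : ℂ, ∀ ψ ∈ C, ∀ φ ∈ C, star ψ ⬝ᵥ (E *ᵥ φ) = c * (star ψ ⬝ᵥ φ)

/-- The distance of a quantum code: the least number of qubits that carry an undetectable error
(`⊤` if there is none, which happens for one-dimensional codes). -/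
noncomputable def quantumDistance (C : Submodule ℂ (QVec Q)) : ℕ∞ :=
  ⨅ (S : Finset Q) (E : QOp Q) (_ : SupportedOn S E) (_ : ¬ IsDetectable C E), (S.card : ℕ∞)

/-- `C` is an `[[n, k, d]]` quantum code. -/
structure IsQuantumCode (C : Submodule ℂ (QVec Q)) (n k : ℕ) (d : ℕ∞) : Prop where
  length : Fintype.card Q = n
  dimension : Module.finrank ℂ C = 2 ^ k
  distance : quantumDistance C = d

/-- The density matrix `|ψ⟩⟨ψ|`. -/
def density (ψ : QVec Q) : QOp Q := Matrix.vecMulVec ψ (star ψ)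

/-- The basis label on `Q` with value `b` at `j` and given by `x` elsewhere. -/
def insertBit (j : Q) (b : ZMod 2) (x : QBasis {i : Q // i ≠ j}) : QBasis Q :=
  fun i => if h : i = j then b else x ⟨i, h⟩

/-- The partial trace over the qubit `j`. -/
def partialTrace (j : Q) (ρ : QOp Q) : QOp {i : Q // i ≠ j} :=
  Matrix.of fun x y => ∑ b : ZMod 2, ρ (insertBit j b x) (insertBit j b y)

/-- The state `σ` of the remaining qubits, with a maximally mixed qubit `I / 2` put at `j`. -/
noncomputable def fillMixed (j : Q) (σ : QOp {i : Q // i ≠ j}) : QOp Q :=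
  Matrix.of fun x y => if x j = y j then (1 / 2 : ℂ) * σ (fun i => x i) (fun i => y i) else 0

/-- Erasure of the qubit `j`, seen as a state on the full register: `Tr_j ρ ⊗ (I / 2)_j`. -/
noncomputable def eraseQubit (j : Q) (ρ : QOp Q) : QOp Q := fillMixed j (partialTrace j ρ)

/-- `Φ` is a quantum channel supported on the qubits in `S`: it has Kraus operators acting only on
the qubits in `S`. -/
def IsChannelOn (S : Finset Q) (Φ : QOp Q → QOp Q) : Prop :=
  ∃ (m : ℕ) (K : Fin m → QOp Q), (∀ i, SupportedOn S (K i)) ∧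
    ∑ i, (K i)ᴴ * K i = 1 ∧ ∀ ρ, Φ ρ = ∑ i, K i * ρ * (K i)ᴴ

/-- The exact `(r, t, s)`-condition for a family of subsets `Γ j l`, `j : Q`, `l : Fin t`. -/
structure ExactCondition (r t s : ℕ) (Γ : Q → Fin t → Finset Q) : Prop where
  card_eq : ∀ j l, (Γ j l).card = r + 1
  mem : ∀ j l, j ∈ Γ j l
  inter_two : ∀ j l₁ l₂, l₁ ≠ l₂ → (Γ j l₁ ∩ Γ j l₂).card = s + 1
  inter_three : ∀ j l₁ l₂ l₃, l₁ ≠ l₂ → l₁ ≠ l₃ → l₂ ≠ l₃ →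
    Γ j l₁ ∩ Γ j l₂ ∩ Γ j l₃ = {j}

/-- Exact `(r, t, s)`-qLRCs (on qubits). -/
def IsExactQLRC (r t s : ℕ) (C : Submodule ℂ (QVec Q)) : Prop :=
  ∃ Γ : Q → Fin t → Finset Q, ExactCondition r t s Γ ∧
    ∀ (j : Q) (l : Fin t), ∃ Rec : QOp Q → QOp Q, IsChannelOn (Γ j l) Rec ∧
      ∀ ψ ∈ C, star ψ ⬝ᵥ ψ = 1 → Rec (eraseQubit j (density ψ)) = density ψ

end Quantum

/-- The quantum code `Q(G)`: the CSS code with `H_X = H_Z` the parity-check matrix of `G`. -/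
noncomputable def TannerGraph.quantumCode {V W : Type*} [Fintype V] [DecidableEq V]
    (G : TannerGraph V W) : Submodule ℂ (QVec V) :=
  cssCode G.parityCheck G.parityCheck

/-! Write `A`, `B` for the parity-check matrices of the factors and `M` for that of the product. Row
weights are even and two rows overlap in 0 or 2 places, so `A * Aᵀ = 0`; the transposed graphs give
`Aᵀ * A = 0`, and likewise for `B`. Then `M * Mᵀ = 0`, because `M` has Kronecker blocks whose cross
terms occur twice.

Dimension: code states are the functions on `ker M` invariant under the row space `R` of `M`, so `k
= dim (ker M / R)`. For `A` this homology has dimension `2k₁ - n₁`. Tensor products of dual families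
in the factors give a dual family for `M`, which is the Künneth-type lower bound.

Distance: a vector in `ker M` is a pair of matrices with `A x = y B` and `x Bᵀ = Aᵀ y`. For `u ∈ ker
A` the vector `u x` lies in `ker B` and is no heavier than the pair, so low weight forces it to
vanish; dually for `y`. A generalized inverse of `A` then exhibits the pair as an element of `R`.
Errors on a set where every kernel vector lies in `R` satisfy the Knill–Laflamme condition.

Locality: when `tᵢ = rᵢ + 1` the product graph is again exact, and `Γ_l(j)` is the neighbourhood of
the `l`-th check at `j`. With `h` the row of that check, erasure of `j` is a uniform mixture of four
Paulis at `j`. As `h j = 1`, the commuting pair `X^h`, `Z^h` tells all four apart, so one check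
suffices for recovery. -/

open scoped Kronecker

/-! ### Linear algebra: generalized inverses and the homology of a self-orthogonal matrix -/

section DotProduct

variable {K V W : Type*} [Field K] [Fintype V] [Fintype W]

theorem exists_dotProduct_eq (f : (V → K) →ₗ[K] K) : ∃ b : V → K, ∀ x, f x = b ⬝ᵥ x := by
  classical
  refine ⟨fun i => f (Pi.single i 1), fun x => ?_⟩
  rw [LinearMap.pi_apply_eq_sum_univ f x]
  simp only [dotProduct, smul_eq_mul]
  refine Finset.sum_congr rfl fun i _ => ?_
  rw [mul_comm]
  congr 2
  ext j
  simp [Pi.single_apply, eq_comm]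

theorem exists_dotProduct_ne_zero {N : Submodule K (V → K)} {y : V → K} (hy : y ∉ N) :
    ∃ b : V → K, (∀ x ∈ N, b ⬝ᵥ x = 0) ∧ b ⬝ᵥ y ≠ 0 := by
  obtain ⟨f, hf, hN⟩ := Submodule.exists_le_ker_of_notMem hy
  obtain ⟨b, hb⟩ := exists_dotProduct_eq f
  exact ⟨b, fun x hx => by rw [← hb]; exact hN hx, by rwa [← hb]⟩

/-- A section of `A` over its range, extended to the whole space, is such a generalized inverse. Its
use: the columns of `1 - S * A` lie in `ker A`, so orthogonality to `ker A` turns into an explicit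
formula. -/
theorem Matrix.exists_mul_mul_eq_self (A : Matrix W V K) : ∃ S : Matrix V W K, A * S * A = A := by
  classical
  obtain ⟨g, hg⟩ := A.mulVecLin.rangeRestrict.exists_rightInverse_of_surjective
    (LinearMap.range_rangeRestrict _)
  obtain ⟨g', hg'⟩ := LinearMap.exists_extend g
  refine ⟨LinearMap.toMatrix' g', ?_⟩
  apply Matrix.toLin'.injective
  ext1 v
  ext1
  simp only [Matrix.toLin'_mul, Matrix.toLin'_toMatrix', LinearMap.comp_apply, Matrix.toLin'_apply]
  have h1 : g' (A *ᵥ Pi.single v 1) = g (A.mulVecLin.rangeRestrict (Pi.single v 1)) := by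
    rw [← hg']; rfl
  have h2 := congrArg Subtype.val
    (LinearMap.congr_fun hg (A.mulVecLin.rangeRestrict (Pi.single v 1)))
  simp only [LinearMap.coe_single, LinearMap.comp_apply] at *
  erw [h1]
  exact h2

/-- The space spanned by the rows of a matrix. -/
def Matrix.rowSpace (M : Matrix W V K) : Submodule K (V → K) := LinearMap.range Mᵀ.mulVecLin

omit [Fintype V] in
theorem Matrix.row_mem_rowSpace (M : Matrix W V K) (w : W) : M w ∈ M.rowSpace := by
  classical
  exact ⟨Pi.single w 1, by ext; simp⟩

theorem Matrix.mulVec_eq_zero_of_forall_rowSpace {M : Matrix W V K} {b : V → K}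
    (hb : ∀ x ∈ M.rowSpace, b ⬝ᵥ x = 0) : M *ᵥ b = 0 := by
  ext w
  rw [Matrix.mulVec, dotProduct_comm]
  exact hb _ (M.row_mem_rowSpace w)

theorem Matrix.dotProduct_eq_zero_of_mem_rowSpace {M : Matrix W V K} {b x : V → K}
    (hb : M *ᵥ b = 0) (hx : x ∈ M.rowSpace) : b ⬝ᵥ x = 0 := by
  obtain ⟨p, rfl⟩ := hx
  rw [Matrix.mulVecLin_apply, Matrix.mulVec_transpose, dotProduct_comm, ← Matrix.dotProduct_mulVec,
    hb, dotProduct_zero]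

theorem Matrix.rowSpace_le_ker {M : Matrix W V K} (hM : M * Mᵀ = 0) :
    M.rowSpace ≤ LinearMap.ker M.mulVecLin := by
  rintro _ ⟨p, rfl⟩
  rw [LinearMap.mem_ker, Matrix.mulVecLin_apply, Matrix.mulVecLin_apply, Matrix.mulVec_mulVec, hM,
    Matrix.zero_mulVec]

/-- The homology `ker M / range Mᵀ` of a self-orthogonal matrix `M`. -/
abbrev Matrix.SelfHomology (M : Matrix W V K) : Type _ :=
  LinearMap.ker M.mulVecLin ⧸ M.rowSpace.submoduleOf (LinearMap.ker M.mulVecLin)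

theorem Matrix.finrank_rowSpace_add_finrank_ker (M : Matrix W V K) :
    Module.finrank K M.rowSpace + Module.finrank K (LinearMap.ker M.mulVecLin) =
      Fintype.card V := by
  have h := M.mulVecLin.finrank_range_add_finrank_ker
  rw [Module.finrank_fintype_fun_eq_card] at h
  rw [← h]
  congr 1
  exact Matrix.rank_transpose M

/-- The row space has dimension `n - k` and lies inside the kernel, so the quotient has dimension `k
- (n - k)`: this is the source of the factors `2k - n`. -/
theorem Matrix.finrank_selfHomology {M : Matrix W V K} (hM : M * Mᵀ = 0) :
    (Module.finrank K M.SelfHomology : ℤ) =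
      2 * Module.finrank K (LinearMap.ker M.mulVecLin) - Fintype.card V := by
  have h1 := M.finrank_rowSpace_add_finrank_ker
  have h2 := (M.rowSpace.submoduleOf (LinearMap.ker M.mulVecLin)).finrank_quotient_add_finrank
  have h3 : Module.finrank K (M.rowSpace.submoduleOf (LinearMap.ker M.mulVecLin)) =
      Module.finrank K M.rowSpace :=
    (Submodule.submoduleOfEquivOfLe (Matrix.rowSpace_le_ker hM)).finrank_eq
  change Module.finrank K M.SelfHomology + _ = _ at h2
  omega

/-- The `e i` lift a basis of the homology. The coordinate functionals, extended from `ker M` to the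
whole space, are dot products with vectors `f i`; they vanish on the row space, which is what places
`f i` in `ker M`. -/
theorem Matrix.exists_dual_family {M : Matrix W V K} (hM : M * Mᵀ = 0) :
    ∃ e f : Fin (Module.finrank K M.SelfHomology) → V → K,
      (∀ i, M *ᵥ e i = 0) ∧ (∀ i, M *ᵥ f i = 0) ∧
      ∀ i j, f i ⬝ᵥ e j = if i = j then 1 else 0 := by
  classical
  let b := Module.finBasis K M.SelfHomology
  let q := (M.rowSpace.submoduleOf (LinearMap.ker M.mulVecLin)).mkQ
  have hq : ∀ i, ∃ x, q x = b i := fun i => Submodule.mkQ_surjective _ _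
  choose e he using hq
  have hf : ∀ i, ∃ f : V → K, ∀ x : LinearMap.ker M.mulVecLin, f ⬝ᵥ x.1 = b.coord i (q x) := by
    intro i
    obtain ⟨g, hg⟩ := LinearMap.exists_extend ((b.coord i).comp q)
    obtain ⟨f, hf⟩ := exists_dotProduct_eq g
    refine ⟨f, fun x => ?_⟩
    rw [← hf]
    exact LinearMap.congr_fun hg x
  choose f hf using hf
  refine ⟨fun i => (e i).1, f, fun i => (e i).2, fun i => ?_, fun i j => ?_⟩
  · apply Matrix.mulVec_eq_zero_of_forall_rowSpace
    intro x hx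
    rw [hf i ⟨x, Matrix.rowSpace_le_ker hM hx⟩]
    have : q ⟨x, Matrix.rowSpace_le_ker hM hx⟩ = 0 := by
      rw [← LinearMap.mem_ker, Submodule.ker_mkQ]
      exact hx
    rw [this, map_zero]
  · rw [hf, he, Module.Basis.coord_apply, b.repr_self, Finsupp.single_apply]
    simp only [eq_comm]

/-- Pairing with `f i ∈ ker M` annihilates the row space, hence descends to the homology, where it
sends the classes of the `e i` to the standard basis. -/
theorem Matrix.card_le_finrank_selfHomology {M : Matrix W V K} {ι : Type*} [Fintype ι]
    [DecidableEq ι] (e f : ι → V → K) (he : ∀ i, M *ᵥ e i = 0) (hf : ∀ i, M *ᵥ f i = 0)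
    (hef : ∀ i j, f i ⬝ᵥ e j = if i = j then 1 else 0) :
    Fintype.card ι ≤ Module.finrank K M.SelfHomology := by
  let F : LinearMap.ker M.mulVecLin →ₗ[K] (ι → K) :=
    (Matrix.mulVecLin (Matrix.of f)).comp (Submodule.subtype _)
  let g : M.SelfHomology →ₗ[K] (ι → K) := Submodule.liftQ _ F (by
    intro x hx
    ext i
    exact Matrix.dotProduct_eq_zero_of_mem_rowSpace (hf i) hx)
  have hli : LinearIndependent K
      (fun i => Submodule.Quotient.mk ⟨e i, he i⟩ : ι → M.SelfHomology) := by
    apply LinearIndependent.of_comp g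
    convert (Pi.basisFun K ι).linearIndependent using 1
    ext j i
    simp only [Pi.basisFun_apply, Pi.single_apply]
    exact hef i j
  exact hli.fintype_card_le_finrank

end DotProduct

/-! ### Parity-check matrices of exact graphs and of products -/

namespace TannerGraph

variable {V W : Type*}

theorem parityCheck_apply {G : TannerGraph V W} {w : W} {v : V} {p : Prop} [Decidable p]
    (h : G.Adj v w ↔ p) : G.parityCheck w v = if p then 1 else 0 := by
  by_cases hp : p <;> simp [parityCheck, h, hp]

/-- Entries of the product count common neighbours modulo 2: `r + 1` on the diagonal, 0 or 2 off it.
-/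
theorem IsExact.parityCheck_mul_transpose [Fintype V] [Fintype W] {G : TannerGraph V W} {r t : ℕ}
    (h : G.IsExact r t 1) (hr : Odd r) : G.parityCheck * G.parityCheckᵀ = 0 := by
  classical
  ext w w'
  have key : (G.parityCheck * G.parityCheckᵀ) w w' =
      ((Finset.univ.filter fun v => G.Adj v w ∧ G.Adj v w').card : ZMod 2) := by
    rw [Matrix.mul_apply, Finset.card_filter, Nat.cast_sum]
    refine Finset.sum_congr rfl fun v _ => ?_
    simp only [parityCheck, Matrix.of_apply, Matrix.transpose_apply]
    by_cases h1 : G.Adj v w <;> by_cases h2 : G.Adj v w' <;> simp [h1, h2]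
  rw [key, Matrix.zero_apply, ZMod.natCast_eq_zero_iff_even]
  by_cases hw : w = w'
  · subst hw
    have := h.check_degree w
    simp only [and_self]
    rw [show (Finset.univ.filter fun v => G.Adj v w).card = r + 1 by convert this]
    exact hr.add_one
  · rcases h.two_checks w w' hw with h0 | h0
    · rw [show (Finset.univ.filter fun v => G.Adj v w ∧ G.Adj v w').card = 0 by convert h0]
      exact Even.zero
    · rw [show (Finset.univ.filter fun v => G.Adj v w ∧ G.Adj v w').card = 2 by convert h0]
      exact even_two

variable {V₁ W₁ V₂ W₂ : Type*}
  [DecidableEq V₁] [DecidableEq W₁] [DecidableEq V₂] [DecidableEq W₂]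

theorem parityCheck_prod (G₁ : TannerGraph V₁ W₁) (G₂ : TannerGraph V₂ W₂) :
    (G₁.prod G₂).parityCheck =
      Matrix.fromBlocks (G₁.parityCheck ⊗ₖ (1 : Matrix V₂ V₂ (ZMod 2)))
        ((1 : Matrix W₁ W₁ (ZMod 2)) ⊗ₖ G₂.parityCheckᵀ)
        ((1 : Matrix V₁ V₁ (ZMod 2)) ⊗ₖ G₂.parityCheck)
        (G₁.parityCheckᵀ ⊗ₖ (1 : Matrix W₂ W₂ (ZMod 2))) := by
  classical
  ext (⟨w₁, u₂⟩ | ⟨u₁, w₂⟩) (⟨v₁, v₂⟩ | ⟨x₁, x₂⟩)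
  · refine (parityCheck_apply (G := G₁.prod G₂) (p := v₂ = u₂ ∧ G₁.Adj v₁ w₁) Iff.rfl).trans ?_
    simp [parityCheck_apply Iff.rfl, Matrix.one_apply, ite_and, eq_comm]
  · refine (parityCheck_apply (G := G₁.prod G₂) (p := x₁ = w₁ ∧ G₂.Adj u₂ x₂) Iff.rfl).trans ?_
    simp [parityCheck_apply Iff.rfl, Matrix.one_apply, ite_and, eq_comm]
    split_ifs <;> rfl
  · refine (parityCheck_apply (G := G₁.prod G₂) (p := v₁ = u₁ ∧ G₂.Adj v₂ w₂) Iff.rfl).trans ?_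
    simp [parityCheck_apply Iff.rfl, Matrix.one_apply, ite_and, eq_comm]
    split_ifs <;> rfl
  · refine (parityCheck_apply (G := G₁.prod G₂) (p := x₂ = w₂ ∧ G₁.Adj u₁ x₁) Iff.rfl).trans ?_
    simp [parityCheck_apply Iff.rfl, Matrix.one_apply, ite_and, eq_comm]

end TannerGraph

/-! ### The product matrix acting on pairs of matrices -/

section Product

variable {K V₁ W₁ V₂ W₂ : Type*} [CommRing K] [CharP K 2]
  [Fintype V₁] [Fintype W₁] [Fintype V₂] [Fintype W₂]
  [DecidableEq V₁] [DecidableEq W₁] [DecidableEq V₂] [DecidableEq W₂]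

/-- The parity-check matrix of a product, in terms of those of the factors. -/
abbrev Matrix.tannerProd (A : Matrix W₁ V₁ K) (B : Matrix W₂ V₂ K) :
    Matrix ((W₁ × V₂) ⊕ (V₁ × W₂)) ((V₁ × V₂) ⊕ (W₁ × W₂)) K :=
  Matrix.fromBlocks (A ⊗ₖ (1 : Matrix V₂ V₂ K)) ((1 : Matrix W₁ W₁ K) ⊗ₖ Bᵀ)
    ((1 : Matrix V₁ V₁ K) ⊗ₖ B) (Aᵀ ⊗ₖ (1 : Matrix W₂ W₂ K))

/-- Diagonal blocks vanish by self-orthogonality of the factors; each off-diagonal block is a sum of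
two equal Kronecker products, zero in characteristic 2. -/
theorem Matrix.tannerProd_mul_transpose {A : Matrix W₁ V₁ K} {B : Matrix W₂ V₂ K}
    (hA : A * Aᵀ = 0) (hAT : Aᵀ * A = 0) (hB : B * Bᵀ = 0) (hBT : Bᵀ * B = 0) :
    A.tannerProd B * (A.tannerProd B)ᵀ = 0 := by
  simp only [Matrix.tannerProd, Matrix.fromBlocks_transpose, Matrix.fromBlocks_multiply,
    ← Matrix.kroneckerMap_transpose, Matrix.transpose_one, Matrix.transpose_transpose,
    ← Matrix.mul_kronecker_mul, Matrix.one_mul, Matrix.mul_one, hA, hAT, hB, hBT,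
    Matrix.zero_kronecker, Matrix.kronecker_zero, add_zero,
    ← Matrix.fromBlocks_zero]
  congr 1 <;> ext <;> exact CharTwo.add_self_eq_zero _

/-- A pair of matrices as a vector on the disjoint union of the index sets. -/
def Matrix.pairVec {X₁ X₂ Y₁ Y₂ : Type*} (x : Matrix X₁ X₂ K) (y : Matrix Y₁ Y₂ K) :
    (X₁ × X₂) ⊕ (Y₁ × Y₂) → K :=
  Sum.elim (fun i => x i.1 i.2) (fun i => y i.1 i.2)

omit [CharP K 2] in
theorem Matrix.tannerProd_mulVec (A : Matrix W₁ V₁ K) (B : Matrix W₂ V₂ K)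
    (x : Matrix V₁ V₂ K) (y : Matrix W₁ W₂ K) :
    A.tannerProd B *ᵥ Matrix.pairVec x y = Matrix.pairVec (A * x + y * B) (x * Bᵀ + Aᵀ * y) := by
  ext (⟨w, v⟩ | ⟨v, w⟩) <;>
    simp [Matrix.tannerProd, Matrix.pairVec, Matrix.mulVec, dotProduct,
      Fintype.sum_prod_type, Matrix.one_apply, Matrix.mul_apply, mul_comm]

omit [CharP K 2] [Fintype V₁] [Fintype W₁] [Fintype V₂] [Fintype W₂] in
theorem Matrix.tannerProd_transpose (A : Matrix W₁ V₁ K) (B : Matrix W₂ V₂ K) :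
    (A.tannerProd B)ᵀ = Aᵀ.tannerProd B := by
  simp [Matrix.tannerProd, Matrix.fromBlocks_transpose, ← Matrix.kroneckerMap_transpose]

omit [CharP K 2] in
theorem Matrix.tannerProd_transpose_mulVec (A : Matrix W₁ V₁ K) (B : Matrix W₂ V₂ K)
    (p : Matrix W₁ V₂ K) (q : Matrix V₁ W₂ K) :
    (A.tannerProd B)ᵀ *ᵥ Matrix.pairVec p q = Matrix.pairVec (Aᵀ * p + q * B) (p * Bᵀ + A * q) := by
  rw [Matrix.tannerProd_transpose, Matrix.tannerProd_mulVec, Matrix.transpose_transpose]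

omit [CommRing K] [CharP K 2] [Fintype V₁] [Fintype W₁] [Fintype V₂] [Fintype W₂]
  [DecidableEq V₁] [DecidableEq W₁] [DecidableEq V₂] [DecidableEq W₂] in
theorem Matrix.exists_eq_pairVec (c : (V₁ × V₂) ⊕ (W₁ × W₂) → K) :
    ∃ (x : Matrix V₁ V₂ K) (y : Matrix W₁ W₂ K), c = Matrix.pairVec x y :=
  ⟨fun i j => c (.inl (i, j)), fun i j => c (.inr (i, j)), by ext (i | i) <;> rfl⟩

omit [CharP K 2] [Fintype V₁] [Fintype W₁] [Fintype V₂] [Fintype W₂] [DecidableEq V₁]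
  [DecidableEq W₁] [DecidableEq V₂] [DecidableEq W₂] in
theorem Matrix.pairVec_eq_zero_iff {x : Matrix V₁ V₂ K} {y : Matrix W₁ W₂ K} :
    Matrix.pairVec x y = 0 ↔ x = 0 ∧ y = 0 := by
  simp only [funext_iff, Sum.forall, Prod.forall, ← Matrix.ext_iff]
  rfl

end Product

/-! ### Künneth bound and low-weight kernel vectors of the product -/

section FieldProduct

variable {K V₁ W₁ V₂ W₂ : Type*} [Field K] [CharP K 2]
  [Fintype V₁] [Fintype W₁] [Fintype V₂] [Fintype W₂]
  [DecidableEq V₁] [DecidableEq W₁] [DecidableEq V₂] [DecidableEq W₂]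

/-- The preimage under the transposed product matrix is `(Sᵀ x, S y)` with `S` a generalized inverse
of `A`. The hypotheses on `x` and `y` give `Aᵀ Sᵀ x = x` and `A S y = y`; the remaining terms vanish
because `A Aᵀ = 0` and `Aᵀ A = 0`. -/
theorem Matrix.pairVec_mem_rowSpace_tannerProd {A : Matrix W₁ V₁ K} {B : Matrix W₂ V₂ K}
    (hA : A * Aᵀ = 0) (hAT : Aᵀ * A = 0) {x : Matrix V₁ V₂ K} {y : Matrix W₁ W₂ K}
    (hxy : A.tannerProd B *ᵥ Matrix.pairVec x y = 0)
    (hx : ∀ u, A *ᵥ u = 0 → u ᵥ* x = 0) (hy : ∀ u, Aᵀ *ᵥ u = 0 → u ᵥ* y = 0) :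
    Matrix.pairVec x y ∈ (A.tannerProd B).rowSpace := by
  rw [Matrix.tannerProd_mulVec, Matrix.pairVec_eq_zero_iff] at hxy
  obtain ⟨h1, h2⟩ := hxy
  have h1' : A * x = y * B := by
    ext i j
    have := congrFun₂ h1 i j
    exact CharTwo.add_eq_zero.mp this
  have h2' : x * Bᵀ = Aᵀ * y := by
    ext i j
    have := congrFun₂ h2 i j
    exact CharTwo.add_eq_zero.mp this
  obtain ⟨S, hS⟩ := A.exists_mul_mul_eq_self
  have hx' : Aᵀ * (Sᵀ * x) = x := by
    have : (1 - S * A)ᵀ * x = 0 := by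
      ext i j
      refine congrFun (hx (fun k => (1 - S * A : Matrix V₁ V₁ K) k i) ?_) j
      have h : A * (1 - S * A) = 0 := by
        rw [Matrix.mul_sub, ← Matrix.mul_assoc, hS, Matrix.mul_one, sub_self]
      ext k
      exact congrFun₂ h k i
    rw [Matrix.transpose_sub, Matrix.transpose_mul, Matrix.transpose_one, Matrix.sub_mul,
      Matrix.one_mul, sub_eq_zero] at this
    rw [← Matrix.mul_assoc, ← this]
  have hy' : A * (S * y) = y := by
    have : (1 - A * S) * y = 0 := by
      ext i j
      refine congrFun (hy (fun k => (1 - A * S : Matrix W₁ W₁ K) i k) ?_) j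
      have h : (1 - A * S) * A = 0 := by
        rw [Matrix.sub_mul, hS, Matrix.one_mul, sub_self]
      ext k
      rw [Matrix.mulVec_transpose]
      exact congrFun₂ h i k
    rw [Matrix.sub_mul, Matrix.one_mul, sub_eq_zero] at this
    rw [← Matrix.mul_assoc, ← this]
  refine ⟨Matrix.pairVec (Sᵀ * x) (S * y), ?_⟩
  rw [Matrix.mulVecLin_apply, Matrix.tannerProd_transpose_mulVec, hx', hy', Matrix.mul_assoc S,
    ← h1', Matrix.mul_assoc Sᵀ, h2']
  congr 1
  -- The cross term is `S y B = S A x = S (A Aᵀ) Sᵀ x = 0`.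
  · nth_rewrite 2 [← hx']
    rw [← Matrix.mul_assoc A, hA]
    simp
  · nth_rewrite 1 [← hy']
    rw [← Matrix.mul_assoc Aᵀ, hAT]
    simp

omit [CharP K 2] [DecidableEq V₁] [DecidableEq W₁] [DecidableEq V₂] [DecidableEq W₂] in
theorem Matrix.pairVec_dotProduct (x x' : Matrix V₁ V₂ K) (y y' : Matrix W₁ W₂ K) :
    Matrix.pairVec x y ⬝ᵥ Matrix.pairVec x' y' =
      ∑ i, ∑ j, x i j * x' i j + ∑ i, ∑ j, y i j * y' i j := by
  simp [Matrix.pairVec, dotProduct, Fintype.sum_prod_type]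

theorem Matrix.sum_vecMulVec_mul_vecMulVec {K α β : Type*} [CommRing K] [Fintype α] [Fintype β]
    (a b : α → K) (c d : β → K) :
    ∑ i, ∑ j, Matrix.vecMulVec a c i j * Matrix.vecMulVec b d i j = (a ⬝ᵥ b) * (c ⬝ᵥ d) := by
  simp only [Matrix.vecMulVec_apply, dotProduct, Finset.sum_mul_sum]
  exact Finset.sum_congr rfl fun i _ => Finset.sum_congr rfl fun j _ => by ring

omit [CharP K 2] in
-- Rank-one matrices built from dual families of `A` and `B` go in the first component, those from
-- `Aᵀ` and `Bᵀ` in the second. Pairings multiply within a component and vanish across components,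
-- so the union is again dual.
theorem Matrix.mul_finrank_le_finrank_selfHomology_tannerProd {A : Matrix W₁ V₁ K}
    {B : Matrix W₂ V₂ K}
    (hA : A * Aᵀ = 0) (hAT : Aᵀ * A = 0) (hB : B * Bᵀ = 0) (hBT : Bᵀ * B = 0) :
    Module.finrank K A.SelfHomology * Module.finrank K B.SelfHomology +
      Module.finrank K Aᵀ.SelfHomology * Module.finrank K Bᵀ.SelfHomology ≤
      Module.finrank K (A.tannerProd B).SelfHomology := by
  obtain ⟨e₁, f₁, he₁, hf₁, h₁⟩ := Matrix.exists_dual_family hA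
  obtain ⟨e₂, f₂, he₂, hf₂, h₂⟩ := Matrix.exists_dual_family hB
  obtain ⟨e₃, f₃, he₃, hf₃, h₃⟩ := Matrix.exists_dual_family (M := Aᵀ) (by simpa using hAT)
  obtain ⟨e₄, f₄, he₄, hf₄, h₄⟩ := Matrix.exists_dual_family (M := Bᵀ) (by simpa using hBT)
  have aux (x₁ : V₁ → K) (x₂ : V₂ → K) (h₁ : A *ᵥ x₁ = 0) (h₂ : B *ᵥ x₂ = 0) :
      A.tannerProd B *ᵥ Matrix.pairVec (Matrix.vecMulVec x₁ x₂) 0 = 0 := by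
    rw [Matrix.tannerProd_mulVec, Matrix.mul_vecMulVec, Matrix.vecMulVec_mul, h₁,
      Matrix.vecMul_transpose, h₂]
    rw [Matrix.pairVec_eq_zero_iff]
    constructor <;> ext <;> simp [Matrix.vecMulVec_apply]
  have aux' (x₁ : W₁ → K) (x₂ : W₂ → K) (h₁ : Aᵀ *ᵥ x₁ = 0) (h₂ : Bᵀ *ᵥ x₂ = 0) :
      A.tannerProd B *ᵥ Matrix.pairVec 0 (Matrix.vecMulVec x₁ x₂) = 0 := by
    rw [Matrix.tannerProd_mulVec, Matrix.mul_vecMulVec, Matrix.vecMulVec_mul, h₁,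
      ← Matrix.mulVec_transpose, h₂]
    rw [Matrix.pairVec_eq_zero_iff]
    constructor <;> ext <;> simp [Matrix.vecMulVec_apply]
  have := Matrix.card_le_finrank_selfHomology (M := A.tannerProd B)
    (ι := (Fin (Module.finrank K A.SelfHomology) × Fin (Module.finrank K B.SelfHomology)) ⊕
      (Fin (Module.finrank K Aᵀ.SelfHomology) × Fin (Module.finrank K Bᵀ.SelfHomology)))
    (Sum.elim (fun i => Matrix.pairVec (Matrix.vecMulVec (e₁ i.1) (e₂ i.2)) 0)
      (fun i => Matrix.pairVec 0 (Matrix.vecMulVec (e₃ i.1) (e₄ i.2))))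
    (Sum.elim (fun i => Matrix.pairVec (Matrix.vecMulVec (f₁ i.1) (f₂ i.2)) 0)
      (fun i => Matrix.pairVec 0 (Matrix.vecMulVec (f₃ i.1) (f₄ i.2))))
    (by rintro (i | i)
        · exact aux _ _ (he₁ _) (he₂ _)
        · exact aux' _ _ (he₃ _) (he₄ _))
    (by rintro (i | i)
        · exact aux _ _ (hf₁ _) (hf₂ _)
        · exact aux' _ _ (hf₃ _) (hf₄ _))
    (by rintro (⟨i, i'⟩ | ⟨i, i'⟩) (⟨j, j'⟩ | ⟨j, j'⟩) <;>
          simp only [Sum.elim_inl, Sum.elim_inr, Matrix.pairVec_dotProduct,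
            Matrix.sum_vecMulVec_mul_vecMulVec, h₁, h₂, h₃, h₄,
            Matrix.zero_apply, mul_zero, zero_mul, Finset.sum_const_zero, add_zero, zero_add,
            Sum.inl.injEq, Sum.inr.injEq, Prod.mk.injEq, reduceCtorEq, if_false, ite_and,
            mul_ite, mul_one] <;>
          split_ifs <;> rfl)
  simpa using this

variable [DecidableEq K]

omit [CharP K 2] [DecidableEq V₁] [DecidableEq V₂] [Fintype W₁] [Fintype W₂]
  [DecidableEq W₁] [DecidableEq W₂] in
-- A nonzero coordinate of `u ᵥ* x` needs a nonzero entry of `x` in that column.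
theorem hammingNorm_vecMul_le (u : V₁ → K) (x : Matrix V₁ V₂ K) :
    hammingNorm (u ᵥ* x) ≤ (Finset.univ.filter fun i : V₁ × V₂ => x i.1 i.2 ≠ 0).card := by
  refine Finset.card_le_card_of_surjOn Prod.snd ?_
  intro j hj
  simp only [Finset.coe_filter, Finset.mem_univ, true_and, Set.mem_ofPred_eq] at hj
  obtain ⟨i, hi⟩ : ∃ i, x i j ≠ 0 := by
    by_contra! h
    exact hj (by simp [Matrix.vecMul, dotProduct, h])
  exact ⟨(i, j), by simpa using hi, rfl⟩

omit [CharP K 2] [DecidableEq V₁] [DecidableEq V₂] [DecidableEq W₁] [DecidableEq W₂] in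
theorem Matrix.hammingNorm_pairVec (x : Matrix V₁ V₂ K) (y : Matrix W₁ W₂ K) :
    hammingNorm (Matrix.pairVec x y) =
      (Finset.univ.filter fun i : V₁ × V₂ => x i.1 i.2 ≠ 0).card +
      (Finset.univ.filter fun i : W₁ × W₂ => y i.1 i.2 ≠ 0).card := by
  simp only [hammingNorm, Finset.card_filter, Fintype.sum_sum_type]
  rfl

theorem Matrix.mem_rowSpace_tannerProd_of_hammingNorm_lt {A : Matrix W₁ V₁ K} {B : Matrix W₂ V₂ K}
    (hA : A * Aᵀ = 0) (hAT : Aᵀ * A = 0) {c : (V₁ × V₂) ⊕ (W₁ × W₂) → K}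
    (hc : A.tannerProd B *ᵥ c = 0)
    (hB : ∀ z, B *ᵥ z = 0 → z ≠ 0 → hammingNorm c < hammingNorm z)
    (hBT : ∀ z, Bᵀ *ᵥ z = 0 → z ≠ 0 → hammingNorm c < hammingNorm z) :
    c ∈ (A.tannerProd B).rowSpace := by
  obtain ⟨x, y, rfl⟩ := Matrix.exists_eq_pairVec c
  have hxy := hc
  rw [Matrix.tannerProd_mulVec, Matrix.pairVec_eq_zero_iff] at hxy
  obtain ⟨h1, h2⟩ := hxy
  refine Matrix.pairVec_mem_rowSpace_tannerProd hA hAT hc ?_ ?_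
  · intro u hu
    by_contra hne
    refine absurd (hB _ ?_ hne) ?_
    -- Since `u Aᵀ = 0`, multiplying `x Bᵀ + Aᵀ y = 0` by `u` on the left leaves `(u x) Bᵀ = 0`.
    · have := congrArg (u ᵥ* ·) h2
      simp only [Matrix.vecMul_add, ← Matrix.vecMul_vecMul, Matrix.vecMul_transpose, hu,
        Matrix.zero_vecMul, add_zero, Matrix.vecMul_zero] at this
      exact this
    · rw [not_lt, Matrix.hammingNorm_pairVec]
      exact (hammingNorm_vecMul_le u x).trans (Nat.le_add_right _ _)
  · intro u hu
    by_contra hne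
    refine absurd (hBT _ ?_ hne) ?_
    · have := congrArg (u ᵥ* ·) h1
      simp only [Matrix.vecMul_add, ← Matrix.vecMul_vecMul, ← Matrix.mulVec_transpose A, hu,
        Matrix.zero_vecMul, zero_add, Matrix.vecMul_zero] at this
      rw [Matrix.mulVec_transpose]
      exact this
    · rw [not_lt, Matrix.hammingNorm_pairVec]
      exact (hammingNorm_vecMul_le u y).trans (Nat.le_add_left _ _)

end FieldProduct

/-! ### Exactness of the product graph -/

namespace TannerGraph

variable {V W : Type*} [Fintype V] [Fintype W]

theorem IsExact.exists_pair {G : TannerGraph V W} {r t : ℕ} (h : G.IsExact r t 1) {w w' : W}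
    (hw : w ≠ w') {u : V} (h1 : G.Adj u w) (h2 : G.Adj u w') :
    ∃ a b, a ≠ b ∧ ∀ v, G.Adj v w ∧ G.Adj v w' ↔ v = a ∨ v = b := by
  classical
  rcases h.two_checks w w' hw with h0 | h0
  · rw [Finset.card_eq_zero] at h0
    have : u ∈ (∅ : Finset V) := by rw [← h0]; simp [h1, h2]
    simp at this
  · obtain ⟨a, b, hab, he⟩ := Finset.card_eq_two.mp h0
    refine ⟨a, b, hab, fun v => ?_⟩
    have := Finset.ext_iff.mp he v
    simpa using this

theorem IsExact.eq_of_three {G : TannerGraph V W} {r t s : ℕ} (h : G.IsExact r t s) {w w' w'' : W}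
    (h1 : w ≠ w') (h2 : w ≠ w'') (h3 : w' ≠ w'') {u v : V}
    (hu : G.Adj u w) (hu' : G.Adj u w') (hu'' : G.Adj u w'') (hv : G.Adj v w) (hv' : G.Adj v w')
    (hv'' : G.Adj v w'') :
    u = v := by
  classical
  have hle : (Finset.univ.filter fun v => G.Adj v w ∧ G.Adj v w' ∧ G.Adj v w'').card ≤ 1 := by
    rcases h.three_checks w w' w'' h1 h2 h3 with h0 | h0
    · exact (le_of_eq (by convert h0)).trans (Nat.zero_le 1)
    · exact le_of_eq (by convert h0)
  exact Finset.card_le_one.mp hle u (by simp [hu, hu', hu'']) v (by simp [hv, hv', hv''])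

theorem card_filter_sum {α β : Type*} [Fintype α] [Fintype β] (p : α ⊕ β → Prop)
    [DecidablePred p] : (Finset.univ.filter p).card =
      (Finset.univ.filter fun a => p (.inl a)).card +
      (Finset.univ.filter fun b => p (.inr b)).card := by
  simp only [Finset.card_filter, Fintype.sum_sum_type]

theorem card_filter_fst_eq {α β : Type*} [Fintype α] [Fintype β] (a : α) {p : β → Prop}
    {q : α × β → Prop} [DecidablePred p] [DecidablePred q] (h : ∀ x, q x ↔ x.1 = a ∧ p x.2) :
    (Finset.univ.filter q).card = (Finset.univ.filter p).card := by
  symm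
  refine Finset.card_nbij (fun b => (a, b)) ?_ ?_ ?_
  · intro b hb
    simpa [h] using hb
  · intro b _ b' _ h
    simpa using h
  · rintro ⟨a', b⟩ hx
    simp only [Finset.coe_filter, Finset.mem_univ, true_and, Set.mem_ofPred_eq, h] at hx
    exact ⟨b, by simpa using hx.2, by rw [hx.1]⟩

theorem card_filter_snd_eq {α β : Type*} [Fintype α] [Fintype β] (b : β) {p : α → Prop}
    {q : α × β → Prop} [DecidablePred p] [DecidablePred q] (h : ∀ x, q x ↔ x.2 = b ∧ p x.1) :
    (Finset.univ.filter q).card = (Finset.univ.filter p).card := by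
  symm
  refine Finset.card_nbij (fun a => (a, b)) ?_ ?_ ?_
  · intro a ha
    simpa [h] using ha
  · intro a _ a' _ h
    simpa using h
  · rintro ⟨a, b'⟩ hx
    simp only [Finset.coe_filter, Finset.mem_univ, true_and, Set.mem_ofPred_eq, h] at hx
    exact ⟨a, by simpa using hx.2, by rw [hx.1]⟩

variable {V₁ W₁ V₂ W₂ : Type*} [Fintype V₁] [Fintype W₁] [Fintype V₂] [Fintype W₂]

/-- Two checks of the same type with a common neighbour agree in one coordinate, and the count takes
place in a single factor or its transpose. Two checks of different types have only two candidate
common neighbours, subject to the same adjacency conditions, so both occur or neither. -/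
theorem IsExact.prod {G₁ : TannerGraph V₁ W₁} {G₂ : TannerGraph V₂ W₂} {r₁ r₂ : ℕ}
    (h₁ : G₁.IsExact r₁ (r₁ + 1) 1) (h₁T : G₁.transpose.IsExact r₁ (r₁ + 1) 1)
    (h₂ : G₂.IsExact r₂ (r₂ + 1) 1) (h₂T : G₂.transpose.IsExact r₂ (r₂ + 1) 1) :
    (G₁.prod G₂).IsExact (r₁ + r₂ + 1) (r₁ + r₂ + 2) 1 := by
  classical
  constructor
  · rintro (⟨v₁, v₂⟩ | ⟨w₁, w₂⟩)
    · rw [card_filter_sum, show r₁ + r₂ + 2 = (r₁ + 1) + (r₂ + 1) by ring, ← h₁.bit_degree v₁,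
        ← h₂.bit_degree v₂]
      exact congrArg₂ _ (card_filter_snd_eq v₂ fun _ => and_congr_left' eq_comm)
        (card_filter_fst_eq v₁ fun _ => and_congr_left' eq_comm)
    · rw [card_filter_sum, show r₁ + r₂ + 2 = (r₂ + 1) + (r₁ + 1) by ring, ← h₁.check_degree w₁,
        ← h₂.check_degree w₂]
      exact congrArg₂ _ (card_filter_fst_eq w₁ fun _ => and_congr_left' eq_comm)
        (card_filter_snd_eq w₂ fun _ => and_congr_left' eq_comm)
  · rintro (⟨w₁, v₂⟩ | ⟨v₁, w₂⟩)
    · rw [card_filter_sum, show r₁ + r₂ + 1 + 1 = (r₁ + 1) + (r₂ + 1) by ring,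
        ← h₁.check_degree w₁, ← h₂.bit_degree v₂]
      exact congrArg₂ _ (card_filter_snd_eq v₂ fun _ => Iff.rfl)
        (card_filter_fst_eq w₁ fun _ => Iff.rfl)
    · rw [card_filter_sum, show r₁ + r₂ + 1 + 1 = (r₂ + 1) + (r₁ + 1) by ring,
        ← h₂.check_degree w₂, ← h₁.bit_degree v₁]
      exact congrArg₂ _ (card_filter_fst_eq v₁ fun _ => Iff.rfl)
        (card_filter_snd_eq w₂ fun _ => Iff.rfl)
  · intro c c' hc
    by_cases hne : ∃ j, (G₁.prod G₂).Adj j c ∧ (G₁.prod G₂).Adj j c'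
    · right
      obtain ⟨j, hj, hj'⟩ := hne
      suffices ∃ a b, a ≠ b ∧ ∀ j, (G₁.prod G₂).Adj j c ∧ (G₁.prod G₂).Adj j c' ↔ j = a ∨ j = b by
        obtain ⟨a, b, hab, h⟩ := this
        rw [Finset.card_eq_two]
        refine ⟨a, b, hab, ?_⟩
        ext j
        simpa using h j
      have e1 := @h₁.exists_pair
      have e2 := @h₂.exists_pair
      have e3 := @h₁T.exists_pair
      have e4 := @h₂T.exists_pair
      rcases c with ⟨w₁, u₂⟩ | ⟨u₁, w₂⟩ <;> rcases c' with ⟨w₁', u₂'⟩ | ⟨u₁', w₂'⟩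
      · rcases j with ⟨j₁, j₂⟩ | ⟨j₁, j₂⟩
        · obtain ⟨⟨rfl, h3⟩, rfl, h4⟩ := And.intro hj hj'
          have hw : w₁ ≠ w₁' := fun h => hc (by rw [h])
          obtain ⟨a, b, hab, h⟩ := e1 hw h3 h4
          refine ⟨.inl (a, j₂), .inl (b, j₂), by simpa using hab, ?_⟩
          rintro (⟨x, y⟩ | ⟨x, y⟩) <;> simp only [TannerGraph.prod] <;> grind
        · obtain ⟨⟨rfl, h3⟩, rfl, h4⟩ := And.intro hj hj'
          have hw : u₂ ≠ u₂' := fun h => hc (by rw [h])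
          obtain ⟨a, b, hab, h⟩ := e4 hw h3 h4
          simp only [transpose] at h
          refine ⟨.inr (j₁, a), .inr (j₁, b), by simpa using hab, ?_⟩
          rintro (⟨x, y⟩ | ⟨x, y⟩) <;> simp only [TannerGraph.prod] <;> grind
      -- A bit node of either kind adjacent to both checks has its coordinates forced; both
      -- candidates require `u₁'` adjacent to `w₁` and `u₂` adjacent to `w₂'`.
      · refine ⟨.inl (u₁', u₂), .inr (w₁, w₂'), by simp, ?_⟩
        rcases j with ⟨j₁, j₂⟩ | ⟨j₁, j₂⟩ <;> rintro (⟨x, y⟩ | ⟨x, y⟩) <;>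
          simp only [TannerGraph.prod] at hj hj' ⊢ <;> grind
      · refine ⟨.inl (u₁, u₂'), .inr (w₁', w₂), by simp, ?_⟩
        rcases j with ⟨j₁, j₂⟩ | ⟨j₁, j₂⟩ <;> rintro (⟨x, y⟩ | ⟨x, y⟩) <;>
          simp only [TannerGraph.prod] at hj hj' ⊢ <;> grind
      · rcases j with ⟨j₁, j₂⟩ | ⟨j₁, j₂⟩
        · obtain ⟨⟨rfl, h3⟩, rfl, h4⟩ := And.intro hj hj'
          have hw : w₂ ≠ w₂' := fun h => hc (by rw [h])
          obtain ⟨a, b, hab, h⟩ := e2 hw h3 h4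
          refine ⟨.inl (j₁, a), .inl (j₁, b), by simpa using hab, ?_⟩
          rintro (⟨x, y⟩ | ⟨x, y⟩) <;> simp only [TannerGraph.prod] <;> grind
        · obtain ⟨⟨rfl, h3⟩, rfl, h4⟩ := And.intro hj hj'
          have hw : u₁ ≠ u₁' := fun h => hc (by rw [h])
          obtain ⟨a, b, hab, h⟩ := e3 hw h3 h4
          simp only [transpose] at h
          refine ⟨.inr (a, j₂), .inr (b, j₂), by simpa using hab, ?_⟩
          rintro (⟨x, y⟩ | ⟨x, y⟩) <;> simp only [TannerGraph.prod] <;> grind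
    · left
      push Not at hne
      simpa [Finset.card_eq_zero, Finset.filter_eq_empty_iff] using hne
  · intro c c' c'' hc hc' hc''
    suffices ((Finset.univ.filter fun v => (G₁.prod G₂).Adj v c ∧ (G₁.prod G₂).Adj v c' ∧
      (G₁.prod G₂).Adj v c'').card) ≤ 1 by omega
    rw [Finset.card_le_one]
    intro a ha b hb
    simp only [Finset.mem_filter, Finset.mem_univ, true_and] at ha hb
    have e1 := @h₁.eq_of_three
    have e2 := @h₂.eq_of_three
    have e3 := @h₁T.eq_of_three
    have e4 := @h₂T.eq_of_three
    rcases c with ⟨w₁, u₂⟩ | ⟨u₁, w₂⟩ <;> rcases c' with ⟨w₁', u₂'⟩ | ⟨u₁', w₂'⟩ <;>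
    rcases c'' with ⟨w₁'', u₂''⟩ | ⟨u₁'', w₂''⟩ <;>
    rcases a with ⟨a₁, a₂⟩ | ⟨a₁, a₂⟩ <;> rcases b with ⟨b₁, b₂⟩ | ⟨b₁, b₂⟩ <;>
    simp only [TannerGraph.prod, transpose, ne_eq, Sum.inl.injEq, Sum.inr.injEq, Prod.mk.injEq,
      reduceCtorEq, not_false_eq_true] at hc hc' hc'' ha hb e1 e2 e3 e4 ⊢ <;>
    clear h₁ h₂ h₁T h₂T <;>
    grind
end TannerGraph

/-! ### CSS code states, dimension, and the Knill–Laflamme condition -/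

section Pauli

theorem neg_one_pow_val_add (s t : ZMod 2) :
    (-1 : ℂ) ^ (s + t).val = (-1) ^ s.val * (-1) ^ t.val := by
  revert s t
  have h : ((1 : ZMod 2) + 1) = 0 := by decide
  have h2 : ∀ t : ZMod 2, t = 0 ∨ t = 1 := by decide
  intro s t
  rcases h2 s with rfl | rfl <;> rcases h2 t with rfl | rfl <;> simp [h, ZMod.val_one]

variable {Q : Type*}

theorem QBasis.add_self (a : QBasis Q) : a + a = 0 :=
  funext fun _ => CharTwo.add_self_eq_zero _

variable [Fintype Q] [DecidableEq Q]

theorem pauliX_mulVec_apply (a : QBasis Q) (ψ : QVec Q) (x : QBasis Q) :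
    (pauliX a *ᵥ ψ) x = ψ (x + a) := by
  have h (y : QBasis Q) : x = y + a ↔ y = x + a := by
    constructor <;> rintro rfl <;> rw [add_assoc, QBasis.add_self, add_zero]
  simp [pauliX, Matrix.mulVec, dotProduct, h]

theorem pauliZ_mulVec_apply (b : QBasis Q) (ψ : QVec Q) (x : QBasis Q) :
    (pauliZ b *ᵥ ψ) x = (-1) ^ (b ⬝ᵥ x).val * ψ x := by
  simp [pauliZ, Matrix.mulVec_diagonal]

theorem mem_cssCode {WX WZ : Type*} {HX : Matrix WX Q (ZMod 2)} {HZ : Matrix WZ Q (ZMod 2)}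
    {ψ : QVec Q} : ψ ∈ cssCode HX HZ ↔
      (∀ w, pauliX (HX w) *ᵥ ψ = ψ) ∧ ∀ w, pauliZ (HZ w) *ᵥ ψ = ψ := by
  constructor
  · intro h
    exact ⟨fun w => h _ (Submonoid.subset_closure (.inl ⟨w, rfl⟩)),
      fun w => h _ (Submonoid.subset_closure (.inr ⟨w, rfl⟩))⟩
  · rintro ⟨hX, hZ⟩ g hg
    induction hg using Submonoid.closure_induction with
    | mem g hg =>
      rcases hg with ⟨w, rfl⟩ | ⟨w, rfl⟩
      exacts [hX w, hZ w]
    | one => exact Matrix.one_mulVec _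
    | mul g g' _ _ h h' => rw [← Matrix.mulVec_mulVec, h', h]

variable {W : Type*} [Fintype W] {M : Matrix W Q (ZMod 2)}

/-- `X^h` acts by translation, and `Z^h` by a sign that must be trivial wherever `ψ` is nonzero. -/
theorem mem_cssCode_self {ψ : QVec Q} : ψ ∈ cssCode M M ↔
    (∀ h ∈ M.rowSpace, ∀ x, ψ (x + h) = ψ x) ∧ ∀ x, M *ᵥ x ≠ 0 → ψ x = 0 := by
  rw [mem_cssCode]
  refine and_congr ⟨fun h => ?_, fun h w => ?_⟩ ⟨fun h x hx => ?_, fun h w => ?_⟩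
  · intro a ha
    rw [Matrix.rowSpace, Matrix.range_mulVecLin] at ha
    induction ha using Submodule.span_induction with
    | mem a ha =>
      obtain ⟨w, rfl⟩ := ha
      intro x
      exact (pauliX_mulVec_apply (M w) ψ x).symm.trans (congrFun (h w) x)
    | zero => simp
    | add a b _ _ ha hb => intro x; rw [← add_assoc, hb, ha]
    | smul c a _ ha =>
      intro x
      have h2 : ∀ t : ZMod 2, t = 0 ∨ t = 1 := by decide
      rcases h2 c with rfl | rfl
      · simp
      · simpa using ha x
  · ext x
    rw [pauliX_mulVec_apply]
    exact h _ (M.row_mem_rowSpace w) x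
  · obtain ⟨w, hw⟩ := Function.ne_iff.mp hx
    have := congrFun (h w) x
    rw [pauliZ_mulVec_apply] at this
    have h1 : M w ⬝ᵥ x = 1 := by
      have h2 : ∀ t : ZMod 2, t ≠ 0 → t = 1 := by decide
      exact h2 _ hw
    rw [h1, ZMod.val_one, pow_one, neg_one_mul] at this
    exact self_eq_neg.mp this.symm
  · ext x
    rw [pauliZ_mulVec_apply]
    by_cases hx : M *ᵥ x = 0
    · have : M w ⬝ᵥ x = 0 := congrFun hx w
      simp [this]
    · simp [h x hx]

theorem finrank_cssCode_self (hM : M * Mᵀ = 0) : Module.finrank ℂ (cssCode M M) =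
    2 ^ Module.finrank (ZMod 2) M.SelfHomology := by
  classical
  let F : (M.SelfHomology → ℂ) →ₗ[ℂ] QVec Q :=
    { toFun := fun f x => if h : M *ᵥ x = 0 then f (Submodule.Quotient.mk ⟨x, h⟩) else 0
      map_add' := by
        intro f g
        ext x
        by_cases h : M *ᵥ x = 0 <;> simp [h]
      map_smul' := by
        intro c f
        ext x
        by_cases h : M *ᵥ x = 0 <;> simp [h] }
  have hF (f : M.SelfHomology → ℂ) (x : LinearMap.ker M.mulVecLin) :
      F f x.1 = f (Submodule.Quotient.mk x) := dif_pos x.2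
  have hF' (f : M.SelfHomology → ℂ) {x : QBasis Q} (hx : M *ᵥ x ≠ 0) : F f x = 0 := dif_neg hx
  have hinj : Function.Injective F := by
    intro f g hfg
    ext q
    obtain ⟨x, rfl⟩ := Submodule.Quotient.mk_surjective _ q
    rw [← hF f, hfg, hF]
  have hrange : LinearMap.range F = cssCode M M := by
    ext ψ
    rw [mem_cssCode_self]
    constructor
    · rintro ⟨f, rfl⟩
      refine ⟨fun a ha x => ?_, fun x hx => hF' f hx⟩
      have ha' := Matrix.rowSpace_le_ker hM ha
      by_cases hx : M *ᵥ x = 0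
      · refine (hF f (⟨x, hx⟩ + ⟨a, ha'⟩)).trans ((congrArg f ?_).trans (hF f ⟨x, hx⟩).symm)
        rw [Submodule.Quotient.eq, add_sub_cancel_left]
        exact ha
      · have hxa : M *ᵥ (x + a) ≠ 0 := by
          rw [Matrix.mulVec_add, show M *ᵥ a = 0 from ha', add_zero]
          exact hx
        exact (hF' f hxa).trans (hF' f hx).symm
    · rintro ⟨h1, h2⟩
      -- Invariance of `ψ` under the row space makes the choice of representative irrelevant.
      refine ⟨fun q => ψ q.out.1, ?_⟩
      ext x
      by_cases hx : M *ᵥ x = 0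
      · refine (hF _ ⟨x, hx⟩).trans ?_
        have h3 : Submodule.Quotient.mk (Quotient.out (Submodule.Quotient.mk ⟨x, hx⟩ :
          M.SelfHomology)) = (Submodule.Quotient.mk ⟨x, hx⟩ : M.SelfHomology) :=
          Quotient.out_eq _
        rw [Submodule.Quotient.eq] at h3
        have h4 := h1 _ h3 x
        rw [← h4]
        congr 1
        simp
      · rw [h2 x hx]
        exact hF' _ hx
  have : Fintype M.SelfHomology := Fintype.ofFinite _
  rw [← hrange, LinearMap.finrank_range_of_inj hinj, Module.finrank_fintype_fun_eq_card,
    Module.card_eq_pow_finrank (K := ZMod 2), ZMod.card]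

theorem SupportedOn.apply_add {S : Finset Q} {A : QOp Q} (hA : SupportedOn S A)
    {z : QBasis Q} (hz : ∀ i ∈ S, z i = 0) (x y : QBasis Q) : A (x + z) (y + z) = A x y := by
  obtain ⟨L, hL⟩ := hA
  have h (x : QBasis Q) : (fun i : S => (x + z) i) = fun i : S => x i := by
    ext i
    simp [hz i.1 i.2]
  rw [hL, hL, h, h]
  simp

theorem SupportedOn.eq_of_apply_ne_zero {S : Finset Q} {A : QOp Q} (hA : SupportedOn S A)
    {x y : QBasis Q} (hxy : A x y ≠ 0) {i : Q} (hi : i ∉ S) : x i = y i := by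
  obtain ⟨L, hL⟩ := hA
  by_contra h
  exact hxy (by rw [hL, if_neg (fun h' => h (h' i hi))])

/-- Cleaning by duality: a vector orthogonal to both the row space and all vectors vanishing on `S`
lies in `ker M` with support in `S`, hence in the row space, hence is orthogonal to `y`. -/
theorem exists_add_eq_of_mulVec_eq_zero {S : Finset Q}
    (hS : ∀ c, M *ᵥ c = 0 → (∀ i ∉ S, c i = 0) → c ∈ M.rowSpace) {y : QBasis Q}
    (hy : M *ᵥ y = 0) : ∃ h ∈ M.rowSpace, ∃ z : QBasis Q, (∀ i ∈ S, z i = 0) ∧ h + z = y := by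
  let N : Submodule (ZMod 2) (QBasis Q) :=
    { carrier := {z | ∀ i ∈ S, z i = 0}
      add_mem' := by
        intro a b ha hb i hi
        simp [ha i hi, hb i hi]
      zero_mem' := by simp
      smul_mem' := by
        intro c a ha i hi
        simp [ha i hi] }
  suffices y ∈ M.rowSpace ⊔ N by
    obtain ⟨h, hh, z, hz, e⟩ := Submodule.mem_sup.mp this
    exact ⟨h, hh, z, hz, e⟩
  by_contra hne
  obtain ⟨b, hb, hby⟩ := exists_dotProduct_ne_zero hne
  refine hby ?_
  rw [dotProduct_comm]
  refine Matrix.dotProduct_eq_zero_of_mem_rowSpace hy (hS b ?_ ?_)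
  · exact Matrix.mulVec_eq_zero_of_forall_rowSpace fun x hx => hb x (Submodule.mem_sup_left hx)
  · intro i hi
    have : Pi.single i 1 ∈ N := by
      intro j hj
      exact Pi.single_eq_of_ne (by rintro rfl; exact hi hj) _
    simpa using hb _ (Submodule.mem_sup_right this)

/-- The matrix element becomes a sum of `star ψ y * φ y * G y`, where `G` collects the entries of
`E` along the row space. `G` ignores changes of `y` off `S`, so by cleaning its row-space average is
constant on `ker M`; the invariance of `ψ` and `φ` allows that averaging. -/
theorem isDetectable_cssCode_self {S : Finset Q}
    (hS : ∀ c, M *ᵥ c = 0 → (∀ i ∉ S, c i = 0) → c ∈ M.rowSpace) {E : QOp Q}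
    (hE : SupportedOn S E) : IsDetectable (cssCode M M) E := by
  classical
  let G : QBasis Q → ℂ := fun y => ∑ a : M.rowSpace, E (y + a) y
  have hG {z : QBasis Q} (hz : ∀ i ∈ S, z i = 0) (y : QBasis Q) : G (y + z) = G y := by
    refine Finset.sum_congr rfl fun a _ => ?_
    rw [add_right_comm, hE.apply_add hz]
  have hcard : (Fintype.card M.rowSpace : ℂ) ≠ 0 := Nat.cast_ne_zero.mpr Fintype.card_ne_zero
  refine ⟨(Fintype.card M.rowSpace : ℂ)⁻¹ * ∑ h : M.rowSpace, G h, fun ψ hψ φ hφ => ?_⟩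
  rw [mem_cssCode_self] at hψ hφ
  obtain ⟨hψ1, hψ2⟩ := hψ
  obtain ⟨hφ1, hφ2⟩ := hφ
  have key (y : QBasis Q) : ∑ x, star ψ x * (E x y * φ y) = star ψ y * φ y * G y := by
    by_cases hy : M *ᵥ y = 0
    swap
    · simp [hφ2 y hy]
    rw [← Equiv.sum_comp (Equiv.addLeft y), Finset.mul_sum]
    have h1 (a : M.rowSpace) : star ψ y * φ y * E (y + a) y =
        star ψ (y + a) * (E (y + a) y * φ y) := by
      rw [Pi.star_apply, Pi.star_apply, hψ1 _ a.2]
      ring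
    simp only [h1, Equiv.coe_addLeft]
    rw [← Finset.sum_subtype (Finset.univ.filter fun a => a ∈ M.rowSpace) (by simp)
      (fun a => star ψ (y + a) * (E (y + a) y * φ y)), Finset.sum_filter_of_ne]
    intro a _ ha
    have h2 : ψ (y + a) ≠ 0 := fun h => ha (by simp [h])
    have h3 : E (y + a) y ≠ 0 := fun h => ha (by simp [h])
    -- A nonzero term has `y` and `y + a` in `ker M` differing only on `S`, so its shift `a` already
    -- lies in the row space.
    refine hS a ?_ fun i hi => ?_
    · have h4 : M *ᵥ (y + a) = 0 := by_contra fun h => h2 (hψ2 _ h)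
      rwa [Matrix.mulVec_add, hy, zero_add] at h4
    · simpa using hE.eq_of_apply_ne_zero h3 hi
  have avg (h : M.rowSpace) : ∑ y, star ψ y * φ y * G y = ∑ y, star ψ y * φ y * G (y + h) := by
    rw [← Equiv.sum_comp (Equiv.addRight h.1)]
    refine Finset.sum_congr rfl fun y _ => ?_
    simp [hψ1 _ h.2, hφ1 _ h.2]
  have hsum {y : QBasis Q} (hy : M *ᵥ y = 0) : 
      ∑ h : M.rowSpace, G (y + h) = ∑ h : M.rowSpace, G h := by
    obtain ⟨h₀, hh₀, z, hz, rfl⟩ := exists_add_eq_of_mulVec_eq_zero hS hy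
    rw [← Equiv.sum_comp (Equiv.addLeft (⟨h₀, hh₀⟩ : M.rowSpace)) (fun h => G h)]
    refine Finset.sum_congr rfl fun h _ => ?_
    rw [add_right_comm, hG hz]
    rfl
  have h1 : star ψ ⬝ᵥ (E *ᵥ φ) = ∑ y, star ψ y * φ y * G y := by
    simp only [dotProduct, Matrix.mulVec, Finset.mul_sum]
    rw [Finset.sum_comm]
    exact Finset.sum_congr rfl fun y _ => key y
  have h2 : (Fintype.card M.rowSpace : ℂ) * ∑ y, star ψ y * φ y * G y =
      (∑ h : M.rowSpace, G h) * (star ψ ⬝ᵥ φ) := by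
    calc _ = ∑ h : M.rowSpace, ∑ y, star ψ y * φ y * G y := by simp
      _ = ∑ h : M.rowSpace, ∑ y, star ψ y * φ y * G (y + h) :=
        Finset.sum_congr rfl fun h _ => avg h
      _ = ∑ y, star ψ y * φ y * ∑ h : M.rowSpace, G (y + h) := by
        rw [Finset.sum_comm]
        simp only [Finset.mul_sum]
      _ = ∑ y, star ψ y * φ y * ∑ h : M.rowSpace, G h := by
        refine Finset.sum_congr rfl fun y _ => ?_
        by_cases hy : M *ᵥ y = 0
        · rw [hsum hy]
        · simp [hφ2 y hy]
      _ = _ := by rw [← Finset.sum_mul, mul_comm, dotProduct]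
  rw [h1, mul_assoc, ← h2, inv_mul_cancel_left₀ hcard]

end Pauli

/-! ### Local operators and recovery from one erasure -/

section Recovery

variable {Q : Type*} [Fintype Q] [DecidableEq Q]

/-- This form avoids the local operator `L`, so that closure under sums and products is a check on
matrix entries. -/
theorem supportedOn_iff {S : Finset Q} {A : QOp Q} : SupportedOn S A ↔
    (∀ x y, A x y ≠ 0 → ∀ i ∉ S, x i = y i) ∧
    ∀ z : QBasis Q, (∀ i ∈ S, z i = 0) → ∀ x y, A (x + z) (y + z) = A x y := by
  refine ⟨fun h => ⟨fun x y hxy i hi => h.eq_of_apply_ne_zero hxy hi,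
    fun z hz x y => h.apply_add hz x y⟩, fun ⟨h1, h2⟩ => ?_⟩
  let ext (p : QBasis S) : QBasis Q := fun i => if h : i ∈ S then p ⟨i, h⟩ else 0
  refine ⟨Matrix.of fun p q => A (ext p) (ext q), fun x y => ?_⟩
  split_ifs with hxy
  · let z : QBasis Q := fun i => if i ∈ S then 0 else x i
    have hx : x = ext (fun i => x i) + z := by
      ext i
      by_cases hi : i ∈ S <;> simp [ext, z, hi]
    have hy : y = ext (fun i => y i) + z := by
      ext i
      by_cases hi : i ∈ S <;> simp [ext, z, hi]
      exact (hxy i hi).symm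
    conv_lhs => rw [hx, hy]
    exact h2 z (fun i hi => if_pos hi) _ _
  · by_contra hne
    exact hxy (h1 x y hne)

namespace SupportedOn

variable {S : Finset Q} {A B : QOp Q}

theorem add (hA : SupportedOn S A) (hB : SupportedOn S B) : SupportedOn S (A + B) := by
  rw [supportedOn_iff] at *
  refine ⟨fun x y hxy => ?_, fun z hz x y => ?_⟩
  · by_cases h : A x y = 0
    · exact hB.1 x y fun h' => hxy (by rw [Matrix.add_apply, h, h', add_zero])
    · exact hA.1 x y h
  · rw [Matrix.add_apply, Matrix.add_apply, hA.2 z hz, hB.2 z hz]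

theorem smul (c : ℂ) (hA : SupportedOn S A) : SupportedOn S (c • A) := by
  rw [supportedOn_iff] at *
  refine ⟨fun x y hxy => hA.1 x y fun h => hxy (by rw [Matrix.smul_apply, h, smul_zero]),
    fun z hz x y => ?_⟩
  rw [Matrix.smul_apply, Matrix.smul_apply, hA.2 z hz]

theorem mul (hA : SupportedOn S A) (hB : SupportedOn S B) : SupportedOn S (A * B) := by
  rw [supportedOn_iff] at *
  refine ⟨fun x y hxy i hi => ?_, fun z hz x y => ?_⟩
  · rw [Matrix.mul_apply] at hxy
    obtain ⟨w, -, hw⟩ := Finset.exists_ne_zero_of_sum_ne_zero hxy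
    exact (hA.1 x w (left_ne_zero_of_mul hw) i hi).trans (hB.1 w y (right_ne_zero_of_mul hw) i hi)
  · rw [Matrix.mul_apply, Matrix.mul_apply, ← Equiv.sum_comp (Equiv.addRight z)]
    exact Finset.sum_congr rfl fun w _ => by
      rw [Equiv.coe_addRight, hA.2 z hz, hB.2 z hz]

theorem pauliX {a : QBasis Q} (ha : ∀ i ∉ S, a i = 0) : SupportedOn S (pauliX a) := by
  rw [supportedOn_iff]
  simp only [_root_.pauliX, Matrix.of_apply, ne_eq, ite_eq_right_iff, one_ne_zero, imp_false,
    not_not]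
  refine ⟨?_, fun z _ x y => ?_⟩
  · rintro _ y rfl i hi
    simp [ha i hi]
  · simp only [add_right_comm y z a, add_left_inj]

theorem pauliZ {b : QBasis Q} (hb : ∀ i ∉ S, b i = 0) : SupportedOn S (pauliZ b) := by
  rw [supportedOn_iff]
  refine ⟨fun x y hxy i _ => ?_, fun z hz x y => ?_⟩
  · by_contra h
    exact hxy (Matrix.diagonal_apply_ne _ fun h' => h (congrFun h' i))
  · have h : b ⬝ᵥ z = 0 := Finset.sum_eq_zero fun i _ => by
      by_cases hi : i ∈ S
      · rw [hz i hi, mul_zero]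
      · rw [hb i hi, zero_mul]
    simp [_root_.pauliZ, Matrix.diagonal_apply, dotProduct_add, h]

theorem one : SupportedOn S (1 : QOp Q) := by
  have : (1 : QOp Q) = _root_.pauliX 0 := by
    ext x y
    simp [_root_.pauliX, Matrix.one_apply]
  rw [this]
  exact SupportedOn.pauliX fun _ _ => rfl

end SupportedOn

theorem isChannelOn_of_fintype {S : Finset Q} {ι : Type*} [Fintype ι] (K : ι → QOp Q)
    (hK : ∀ i, SupportedOn S (K i)) (h1 : ∑ i, (K i)ᴴ * K i = 1) :
    IsChannelOn S fun ρ => ∑ i, K i * ρ * (K i)ᴴ := by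
  classical
  let e := (Fintype.equivFin ι).symm
  refine ⟨Fintype.card ι, K ∘ e, fun i => hK _, ?_, fun ρ => ?_⟩
  · rw [← h1]
    exact Equiv.sum_comp e fun i => (K i)ᴴ * K i
  · exact (Equiv.sum_comp e fun i => K i * ρ * (K i)ᴴ).symm

theorem mul_density_mul (A : QOp Q) (ψ : QVec Q) :
    A * density ψ * Aᴴ = density (A *ᵥ ψ) := by
  rw [density, density, Matrix.mul_vecMulVec, Matrix.vecMulVec_mul, Matrix.star_mulVec]

theorem pauliX_mul_self (a : QBasis Q) : pauliX a * pauliX a = 1 := by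
  apply Matrix.mulVec_injective
  ext ψ x
  rw [← Matrix.mulVec_mulVec, pauliX_mulVec_apply, pauliX_mulVec_apply, add_assoc,
    QBasis.add_self, add_zero, Matrix.one_mulVec]

theorem neg_one_pow_val_mul_self (t : ZMod 2) : (-1 : ℂ) ^ t.val * (-1) ^ t.val = 1 := by
  rw [← neg_one_pow_val_add, CharTwo.add_self_eq_zero, ZMod.val_zero, pow_zero]

theorem pauliZ_mul_self (b : QBasis Q) : pauliZ b * pauliZ b = 1 := by
  apply Matrix.mulVec_injective
  ext ψ x
  rw [← Matrix.mulVec_mulVec, pauliZ_mulVec_apply, pauliZ_mulVec_apply, ← mul_assoc,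
    neg_one_pow_val_mul_self, one_mul, Matrix.one_mulVec]

theorem pauliZ_mul_pauliX (b a : QBasis Q) :
    pauliZ b * pauliX a = (-1 : ℂ) ^ (b ⬝ᵥ a).val • (pauliX a * pauliZ b) := by
  apply Matrix.mulVec_injective
  ext ψ x
  rw [Matrix.smul_mulVec, ← Matrix.mulVec_mulVec, ← Matrix.mulVec_mulVec, Pi.smul_apply,
    pauliZ_mulVec_apply, pauliX_mulVec_apply, pauliX_mulVec_apply, pauliZ_mulVec_apply,
    dotProduct_add, neg_one_pow_val_add, smul_eq_mul]
  linear_combination (-(-1 : ℂ) ^ (b ⬝ᵥ x).val * ψ (x + a)) * neg_one_pow_val_mul_self (b ⬝ᵥ a)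

theorem pauliX_mul_pauliZ (a b : QBasis Q) :
    pauliX a * pauliZ b = (-1 : ℂ) ^ (b ⬝ᵥ a).val • (pauliZ b * pauliX a) := by
  rw [pauliZ_mul_pauliX, smul_smul, neg_one_pow_val_mul_self, one_smul]

theorem pauliX_mul_pauliX_comm (a b : QBasis Q) : pauliX a * pauliX b = pauliX b * pauliX a := by
  apply Matrix.mulVec_injective
  ext ψ x
  simp only [← Matrix.mulVec_mulVec, pauliX_mulVec_apply, add_right_comm]

theorem pauliZ_mul_pauliZ_comm (a b : QBasis Q) : pauliZ a * pauliZ b = pauliZ b * pauliZ a := by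
  simp only [pauliZ, Matrix.diagonal_mul_diagonal, mul_comm]

omit [DecidableEq Q] in
theorem conjTranspose_pauliX (a : QBasis Q) : (pauliX a)ᴴ = pauliX a := by
  ext x y
  have h : y = x + a ↔ x = y + a := by
    constructor <;> rintro rfl <;> rw [add_assoc, QBasis.add_self, add_zero]
  simp only [pauliX, Matrix.conjTranspose_apply, Matrix.of_apply, h]
  split_ifs <;> simp

omit [DecidableEq Q] in
theorem conjTranspose_pauliZ (b : QBasis Q) : (pauliZ b)ᴴ = pauliZ b := by
  rw [pauliZ, Matrix.diagonal_conjTranspose]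
  congr 1
  ext y
  simp

/-- The Pauli operator `X^p.1 Z^p.2` on the qubit `j`. -/
def pauliAt (j : Q) (p : ZMod 2 × ZMod 2) : QOp Q :=
  pauliX (Pi.single j p.1) * pauliZ (Pi.single j p.2)

theorem supportedOn_pauliAt {S : Finset Q} {j : Q} (hj : j ∈ S) (p : ZMod 2 × ZMod 2) :
    SupportedOn S (pauliAt j p) := by
  have h (c : ZMod 2) : ∀ i ∉ S, (Pi.single j c : QBasis Q) i = 0 := fun i hi =>
    Pi.single_eq_of_ne (by rintro rfl; exact hi hj) _
  exact (SupportedOn.pauliX (h _)).mul (SupportedOn.pauliZ (h _))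

theorem conjTranspose_pauliAt_mul_self (j : Q) (p : ZMod 2 × ZMod 2) :
    (pauliAt j p)ᴴ * pauliAt j p = 1 := by
  rw [pauliAt, Matrix.conjTranspose_mul, conjTranspose_pauliX, conjTranspose_pauliZ,
    Matrix.mul_assoc, ← Matrix.mul_assoc (pauliX _), pauliX_mul_self, Matrix.one_mul,
    pauliZ_mul_self]

theorem pauliAt_mulVec_apply (j : Q) (p : ZMod 2 × ZMod 2) (ψ : QVec Q) (x : QBasis Q) :
    (pauliAt j p *ᵥ ψ) x =
      (-1) ^ (p.2 * (x j + p.1)).val * ψ (x + Pi.single j p.1) := by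
  rw [pauliAt, ← Matrix.mulVec_mulVec, pauliX_mulVec_apply, pauliZ_mulVec_apply,
    single_dotProduct, Pi.add_apply, Pi.single_eq_same]

theorem pauliX_mul_pauliAt (h : QBasis Q) (j : Q) (p : ZMod 2 × ZMod 2) :
    pauliX h * pauliAt j p = (-1 : ℂ) ^ (p.2 * h j).val • (pauliAt j p * pauliX h) := by
  rw [pauliAt, ← Matrix.mul_assoc, pauliX_mul_pauliX_comm, Matrix.mul_assoc, pauliX_mul_pauliZ,
    Matrix.mul_smul, Matrix.mul_assoc, single_dotProduct]

theorem pauliZ_mul_pauliAt (h : QBasis Q) (j : Q) (p : ZMod 2 × ZMod 2) :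
    pauliZ h * pauliAt j p = (-1 : ℂ) ^ (h j * p.1).val • (pauliAt j p * pauliZ h) := by
  rw [pauliAt, ← Matrix.mul_assoc, pauliZ_mul_pauliX, Matrix.smul_mul, Matrix.mul_assoc,
    pauliZ_mul_pauliZ_comm, ← Matrix.mul_assoc, dotProduct_single]

theorem pauliAt_mulVec_pauliAt (j : Q) (p : ZMod 2 × ZMod 2) (ψ : QVec Q) :
    pauliAt j p *ᵥ (pauliAt j p *ᵥ ψ) = (-1 : ℂ) ^ (p.2 * p.1).val • ψ := by
  ext x
  rw [pauliAt_mulVec_apply, pauliAt_mulVec_apply, add_assoc x, QBasis.add_self, add_zero,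
    ← mul_assoc, ← neg_one_pow_val_add, Pi.add_apply, Pi.single_eq_same, Pi.smul_apply,
    smul_eq_mul]
  congr 3
  linear_combination (p.2 * x j + p.2 * p.1) * CharTwo.two_eq_zero (R := ZMod 2)

omit [Fintype Q] in
theorem insertBit_eq (j : Q) (b : ZMod 2) (x : QBasis Q) :
    insertBit j b (fun i => x i) = x + Pi.single j (x j + b) := by
  ext i
  by_cases h : i = j
  · subst h
    simp [insertBit, ← add_assoc, CharTwo.add_self_eq_zero]
  · simp [insertBit, h]

theorem sum_zmod_two {M : Type*} [AddCommMonoid M] (f : ZMod 2 → M) : ∑ b, f b = f 0 + f 1 :=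
  Fin.sum_univ_two f

/-- Averaging over `Z` at `j` kills the entries with `x j ≠ y j`; averaging over `X` traces out the
bit and makes it maximally mixed. -/
theorem eraseQubit_density (j : Q) (ψ : QVec Q) :
    eraseQubit j (density ψ) = (1 / 4 : ℂ) • ∑ p, density (pauliAt j p *ᵥ ψ) := by
  ext x y
  have h (p : ZMod 2 × ZMod 2) : density (pauliAt j p *ᵥ ψ) x y =
      (-1 : ℂ) ^ (p.2 * (x j + y j)).val *
        density ψ (x + Pi.single j p.1) (y + Pi.single j p.1) := by
    have e : p.2 * (x j + y j) = p.2 * (x j + p.1) + p.2 * (y j + p.1) := by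
      linear_combination (-p.2 * p.1) * CharTwo.two_eq_zero (R := ZMod 2)
    rw [e, neg_one_pow_val_add]
    simp only [density, Matrix.vecMulVec_apply, Pi.star_apply, pauliAt_mulVec_apply, star_mul',
      star_pow, star_neg, star_one]
    ring
  rw [Matrix.smul_apply, Matrix.sum_apply, Fintype.sum_prod_type]
  simp only [h, sum_zmod_two, eraseQubit, fillMixed, partialTrace, Matrix.of_apply, insertBit_eq]
  have h2 : ∀ s t : ZMod 2, s ≠ t → s + t = 1 := by decide
  have h3 : ∀ s : ZMod 2, s = 0 ∨ s = 1 := by decide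
  have h4 : (1 : ZMod 2) + 1 = 0 := by decide
  split_ifs with hxy
  · rw [← hxy, CharTwo.add_self_eq_zero]
    rcases h3 (x j) with h5 | h5 <;> simp [h5, h4] <;> ring
  · rw [h2 _ _ hxy]
    simp [ZMod.val_one]

/-- The product of the projections `(1 + s X^h) / 2` and `(1 + t Z^h) / 2`. -/
noncomputable def stabilizerProj (h : QBasis Q) (s t : ℂ) : QOp Q :=
  (1 / 4 : ℂ) • ((1 + s • pauliX h) * (1 + t • pauliZ h))

theorem supportedOn_stabilizerProj {S : Finset Q} {h : QBasis Q} (hS : ∀ i ∉ S, h i = 0)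
    (s t : ℂ) : SupportedOn S (stabilizerProj h s t) :=
  ((SupportedOn.one.add ((SupportedOn.pauliX hS).smul s)).mul
    (SupportedOn.one.add ((SupportedOn.pauliZ hS).smul t))).smul _

/-- Because `h j = 1`, a `Z` at `j` anticommutes with `X^h` and an `X` at `j` with `Z^h`: the error
permutes the four syndromes. -/
theorem stabilizerProj_mul_pauliAt {h : QBasis Q} {j : Q} (hj : h j = 1) (s t : ℂ)
    (p : ZMod 2 × ZMod 2) : stabilizerProj h s t * pauliAt j p =
      pauliAt j p * stabilizerProj h ((-1) ^ p.2.val * s) ((-1) ^ p.1.val * t) := by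
  have hX (c : ℂ) : (1 + c • pauliX h) * pauliAt j p =
      pauliAt j p * (1 + ((-1) ^ p.2.val * c) • pauliX h) := by
    rw [Matrix.add_mul, Matrix.mul_add, Matrix.smul_mul, pauliX_mul_pauliAt, hj, mul_one,
      Matrix.mul_smul, smul_smul, Matrix.one_mul, Matrix.mul_one, mul_comm c]
  have hZ (c : ℂ) : (1 + c • pauliZ h) * pauliAt j p =
      pauliAt j p * (1 + ((-1) ^ p.1.val * c) • pauliZ h) := by
    rw [Matrix.add_mul, Matrix.mul_add, Matrix.smul_mul, Matrix.one_mul, pauliZ_mul_pauliAt, hj,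
      one_mul, Matrix.mul_smul, smul_smul, Matrix.mul_one, mul_comm c]
  rw [stabilizerProj, stabilizerProj, Matrix.smul_mul, Matrix.mul_assoc, hZ, ← Matrix.mul_assoc,
    hX, Matrix.mul_smul, Matrix.mul_assoc]

/-- Even weight of `h` makes `X^h` and `Z^h` commute, so the product of their projections is an
orthogonal projection. -/
theorem conjTranspose_stabilizerProj_mul_self {h : QBasis Q} (hh : h ⬝ᵥ h = 0) :
    (stabilizerProj h 1 1)ᴴ * stabilizerProj h 1 1 = stabilizerProj h 1 1 := by
  have hZX : pauliZ h * pauliX h = pauliX h * pauliZ h := by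
    rw [pauliZ_mul_pauliX, hh, ZMod.val_zero, pow_zero, one_smul]
  have hcomm : (1 + pauliZ h) * (1 + pauliX h) = (1 + pauliX h) * (1 + pauliZ h) := by
    simp only [Matrix.mul_add, Matrix.add_mul, Matrix.one_mul, Matrix.mul_one, hZX]
    abel
  have hX : (1 + pauliX h) * (1 + pauliX h) = (2 : ℂ) • (1 + pauliX h) := by
    simp only [Matrix.mul_add, Matrix.add_mul, Matrix.one_mul, Matrix.mul_one, pauliX_mul_self,
      two_smul]
    abel
  have hZ : (1 + pauliZ h) * (1 + pauliZ h) = (2 : ℂ) • (1 + pauliZ h) := by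
    simp only [Matrix.mul_add, Matrix.add_mul, Matrix.one_mul, Matrix.mul_one, pauliZ_mul_self,
      two_smul]
    abel
  have h4 : star (1 / 4 : ℂ) = 1 / 4 := by simp
  simp only [stabilizerProj, one_smul, Matrix.conjTranspose_smul, Matrix.conjTranspose_mul,
    Matrix.conjTranspose_add, Matrix.conjTranspose_one, conjTranspose_pauliX,
    conjTranspose_pauliZ, h4]
  rw [hcomm, Matrix.smul_mul, Matrix.mul_smul, Matrix.mul_assoc, ← Matrix.mul_assoc (1 + pauliZ h),
    hcomm, Matrix.mul_assoc, hZ, ← Matrix.mul_assoc, hX]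
  simp only [Matrix.smul_mul, Matrix.mul_smul, smul_smul]
  norm_num

theorem sum_stabilizerProj (h : QBasis Q) :
    ∑ p : ZMod 2 × ZMod 2, stabilizerProj h ((-1) ^ p.2.val) ((-1) ^ p.1.val) = 1 := by
  rw [Fintype.sum_prod_type]
  simp only [sum_zmod_two, stabilizerProj, ZMod.val_zero, ZMod.val_one, pow_zero, pow_one,
    one_smul, neg_smul, ← smul_add, Matrix.mul_add, Matrix.add_mul, Matrix.one_mul, Matrix.mul_one,
    Matrix.neg_mul, Matrix.mul_neg]
  ext x y
  simp only [Matrix.smul_apply, Matrix.add_apply, Matrix.neg_apply, smul_eq_mul]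
  ring

theorem stabilizerProj_mulVec {h : QBasis Q} {ψ : QVec Q} (hX : pauliX h *ᵥ ψ = ψ)
    (hZ : pauliZ h *ᵥ ψ = ψ) (s t : ℂ) :
    stabilizerProj h s t *ᵥ ψ = ((1 + s) * (1 + t) / 4) • ψ := by
  rw [stabilizerProj, Matrix.smul_mulVec, ← Matrix.mulVec_mulVec, Matrix.add_mulVec,
    Matrix.smul_mulVec, Matrix.one_mulVec, Matrix.add_mulVec 1 (t • _), Matrix.smul_mulVec t, hZ,
    Matrix.one_mulVec, Matrix.mulVec_add, Matrix.mulVec_smul, hX]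
  ext x
  simp only [Pi.add_apply, Pi.smul_apply, smul_eq_mul]
  ring

omit [Fintype Q] [DecidableEq Q] in
theorem density_smul_of_neg_one_pow (n : ℕ) (ψ : QVec Q) :
    density ((-1 : ℂ) ^ n • ψ) = density ψ := by
  rcases neg_one_pow_eq_or ℂ n with h | h <;> rw [h] <;> ext <;>
    simp [density, Matrix.vecMulVec_apply]

/-- The Kraus operators apply a Pauli at `j` and then project onto trivial syndrome. Moving the
Pauli through turns `Kᴴ K` into the four syndrome projections, which sum to 1. On a state with error
`q`, only the operator with `p = q` survives. -/
theorem exists_recovery {S : Finset Q} {h : QBasis Q} (hh : h ⬝ᵥ h = 0) (hS : ∀ i ∉ S, h i = 0)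
    {j : Q} (hj : h j = 1) : ∃ Rec : QOp Q → QOp Q, IsChannelOn S Rec ∧
      ∀ ψ, pauliX h *ᵥ ψ = ψ → pauliZ h *ᵥ ψ = ψ →
        Rec (eraseQubit j (density ψ)) = density ψ := by
  have hjS : j ∈ S := by
    by_contra hne
    rw [hS j hne] at hj
    exact zero_ne_one hj
  refine ⟨_, isChannelOn_of_fintype (fun p => stabilizerProj h 1 1 * pauliAt j p)
    (fun p => (supportedOn_stabilizerProj hS 1 1).mul (supportedOn_pauliAt hjS p)) ?_, ?_⟩
  · rw [← sum_stabilizerProj h]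
    refine Finset.sum_congr rfl fun p _ => ?_
    rw [Matrix.conjTranspose_mul, Matrix.mul_assoc, ← Matrix.mul_assoc _ _ (pauliAt j p),
      conjTranspose_stabilizerProj_mul_self hh, stabilizerProj_mul_pauliAt hj, ← Matrix.mul_assoc,
      conjTranspose_pauliAt_mul_self, Matrix.one_mul, mul_one, mul_one]
  · intro ψ hX hZ
    have key (p q : ZMod 2 × ZMod 2) :
        density ((stabilizerProj h 1 1 * pauliAt j p) *ᵥ (pauliAt j q *ᵥ ψ)) =
          if q = p then density ψ else 0 := by
      have h1 : (stabilizerProj h 1 1 * pauliAt j p) *ᵥ (pauliAt j q *ᵥ ψ) =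
          ((1 + (-1) ^ (q.2 + p.2).val) * (1 + (-1) ^ (q.1 + p.1).val) / 4 : ℂ) •
            (pauliAt j p *ᵥ (pauliAt j q *ᵥ ψ)) := by
        rw [Matrix.mulVec_mulVec, stabilizerProj_mul_pauliAt hj, Matrix.mul_assoc,
          stabilizerProj_mul_pauliAt hj, ← Matrix.mul_assoc, ← Matrix.mulVec_mulVec,
          stabilizerProj_mulVec hX hZ, Matrix.mulVec_smul, mul_one, mul_one, neg_one_pow_val_add,
          neg_one_pow_val_add, Matrix.mulVec_mulVec]
      rw [h1]
      have h2 : ∀ s t : ZMod 2, s ≠ t → s + t = 1 := by decide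
      split_ifs with hpq
      · subst hpq
        rw [pauliAt_mulVec_pauliAt, CharTwo.add_self_eq_zero, CharTwo.add_self_eq_zero,
          ZMod.val_zero, pow_zero, show ((1 + 1) * (1 + 1) / 4 : ℂ) = 1 by norm_num, one_smul,
          density_smul_of_neg_one_pow]
      -- A mismatch in either component gives sign `-1` and makes one factor zero.
      · have h3 : ((1 + (-1) ^ (q.2 + p.2).val) * (1 + (-1) ^ (q.1 + p.1).val) / 4 : ℂ) = 0 := by
          by_cases h4 : q.1 = p.1
          · rw [h2 q.2 p.2 fun h5 => hpq (Prod.ext h4 h5)]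
            simp [ZMod.val_one]
          · rw [h2 q.1 p.1 h4]
            simp [ZMod.val_one]
        rw [h3, zero_smul]
        ext
        simp [density, Matrix.vecMulVec_apply]
    simp only [eraseQubit_density, Matrix.mul_smul, Matrix.smul_mul, Matrix.mul_sum, Matrix.sum_mul,
      mul_density_mul, key, ← Finset.smul_sum]
    simp only [Finset.sum_ite_eq', Finset.mem_univ, if_true, Finset.sum_const, Finset.card_univ,
      Fintype.card_prod, ZMod.card]
    -- Each of the four Kraus operators contributes one copy of the state, cancelling the weight `1
    -- / 4`.
    rw [← Nat.cast_smul_eq_nsmul ℂ, smul_smul]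
    norm_num

end Recovery

/-! ### Repair sets and the main theorem -/

theorem TannerGraph.IsExact.isExactQLRC {V W : Type*} [Fintype V] [DecidableEq V] [Fintype W]
    {G : TannerGraph V W} {r t : ℕ} (hG : G.IsExact r t 1) (hr : Odd r) :
    IsExactQLRC r t 1 G.quantumCode := by
  classical
  have hcard (j : V) : Fintype.card {c // G.Adj j c} = t := by
    rw [Fintype.card_subtype]
    convert hG.bit_degree j
  let e (j : V) : Fin t ≃ {c // G.Adj j c} := (Fintype.equivFinOfCardEq (hcard j)).symm
  have hne {j : V} {l l' : Fin t} (h : l ≠ l') : (e j l).1 ≠ (e j l').1 := fun h' =>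
    h ((e j).injective (Subtype.ext h'))
  refine ⟨fun j l => Finset.univ.filter fun v => G.Adj v (e j l), ⟨?_, ?_, ?_, ?_⟩, ?_⟩
  · intro j l
    convert hG.check_degree (e j l)
  · intro j l
    simpa using (e j l).2
  · intro j l₁ l₂ h
    obtain ⟨a, b, hab, h'⟩ := hG.exists_pair (hne h) (e j l₁).2 (e j l₂).2
    rw [Finset.card_eq_two]
    refine ⟨a, b, hab, ?_⟩
    ext v
    simpa using h' v
  · intro j l₁ l₂ l₃ h₁₂ h₁₃ h₂₃
    ext v
    simp only [Finset.mem_inter, Finset.mem_filter, Finset.mem_univ, true_and,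
      Finset.mem_singleton]
    constructor
    · rintro ⟨⟨h1, h2⟩, h3⟩
      exact hG.eq_of_three (hne h₁₂) (hne h₁₃) (hne h₂₃) h1 h2 h3 (e j l₁).2 (e j l₂).2 (e j l₃).2
    · rintro rfl
      exact ⟨⟨(e v l₁).2, (e v l₂).2⟩, (e v l₃).2⟩
  · intro j l
    obtain ⟨Rec, hRec, h⟩ := exists_recovery
      (S := Finset.univ.filter fun v => G.Adj v (e j l)) (h := G.parityCheck (e j l)) (j := j)
      (congrFun₂ (hG.parityCheck_mul_transpose hr) (e j l) (e j l))
      (fun i hi => by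
        rw [parityCheck_apply Iff.rfl, if_neg]
        simpa using hi)
      (by rw [parityCheck_apply Iff.rfl, if_pos (e j l).2])
    refine ⟨Rec, hRec, fun ψ hψ _ => ?_⟩
    obtain ⟨hX, hZ⟩ := mem_cssCode.mp hψ
    exact h ψ (hX _) (hZ _)

theorem minDistance_le_hammingNorm {V : Type*} [Fintype V] {C : Submodule (ZMod 2) (V → ZMod 2)}
    {c : V → ZMod 2} (hc : c ∈ C) (h0 : c ≠ 0) : minDistance C ≤ hammingNorm c := by
  rw [← hammingDist_zero_right]
  exact iInf_le_of_le c <| iInf_le_of_le 0 <| iInf_le_of_le hc <| iInf_le_of_le C.zero_mem <|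
    iInf_le_of_le h0 le_rfl

theorem mainTheorem6
    {V₁ W₁ V₂ W₂ : Type*}
    [Fintype V₁] [DecidableEq V₁] [Fintype W₁] [DecidableEq W₁]
    [Fintype V₂] [DecidableEq V₂] [Fintype W₂] [DecidableEq W₂]
    (G₁ : TannerGraph V₁ W₁) (G₂ : TannerGraph V₂ W₂)
    (r₁ t₁ r₂ t₂ : ℕ)
    (hr₁ : Odd r₁) (hr₂ : Odd r₂)
    (ht₁ : Even t₁) (ht₂ : Even t₂) (ht₁_pos : 0 < t₁) (ht₂_pos : 0 < t₂)
    (hG₁ : G₁.IsExact r₁ t₁ 1) (hG₁T : G₁.transpose.IsExact (t₁ - 1) (r₁ + 1) 1)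
    (hG₂ : G₂.IsExact r₂ t₂ 1) (hG₂T : G₂.transpose.IsExact (t₂ - 1) (r₂ + 1) 1)
    (n₁ k₁ n₁T k₁T n₂ k₂ n₂T k₂T : ℕ) (d₁ d₁T d₂ d₂T : ℕ∞)
    (hC₁ : IsLinearCode G₁.code n₁ k₁ d₁)
    (hC₁T : IsLinearCode G₁.transpose.code n₁T k₁T d₁T)
    (hC₂ : IsLinearCode G₂.code n₂ k₂ d₂)
    (hC₂T : IsLinearCode G₂.transpose.code n₂T k₂T d₂T) :
    (G₁.prod G₂).parityCheck * (G₁.prod G₂).parityCheckᵀ = 0 ∧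
    (∃ (n k : ℕ) (d : ℕ∞), IsQuantumCode (G₁.prod G₂).quantumCode n k d ∧
      n = Fintype.card W₁ * Fintype.card W₂ + Fintype.card V₁ * Fintype.card V₂ ∧
      (2 * (k₁ : ℤ) - n₁) * (2 * (k₂ : ℤ) - n₂) +
          (2 * (k₁T : ℤ) - n₁T) * (2 * (k₂T : ℤ) - n₂T) ≤ (k : ℤ) ∧
      min (min d₁ d₂) (min d₁T d₂T) ≤ d) ∧
    (t₁ = r₁ + 1 → t₂ = r₂ + 1 →
      IsExactQLRC (r₁ + r₂ + 1) (r₁ + r₂ + 2) 1 (G₁.prod G₂).quantumCode) := by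
  have hA := hG₁.parityCheck_mul_transpose hr₁
  have hB := hG₂.parityCheck_mul_transpose hr₂
  have hAT : G₁.parityCheckᵀ * G₁.parityCheck = 0 :=
    hG₁T.parityCheck_mul_transpose (Nat.Even.sub_odd ht₁_pos ht₁ odd_one)
  have hBT : G₂.parityCheckᵀ * G₂.parityCheck = 0 :=
    hG₂T.parityCheck_mul_transpose (Nat.Even.sub_odd ht₂_pos ht₂ odd_one)
  have hH : (G₁.prod G₂).parityCheck = G₁.parityCheck.tannerProd G₂.parityCheck :=
    TannerGraph.parityCheck_prod G₁ G₂
  have hHH : (G₁.prod G₂).parityCheck * (G₁.prod G₂).parityCheckᵀ = 0 := by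
    rw [hH, Matrix.tannerProd_mul_transpose hA hAT hB hBT]
  refine ⟨hHH, ⟨_, _, _, ⟨rfl, finrank_cssCode_self hHH, rfl⟩, ?_, ?_, ?_⟩, ?_⟩
  · simp [add_comm]
  · have h := Matrix.mul_finrank_le_finrank_selfHomology_tannerProd hA hAT hB hBT
    have e1 := Matrix.finrank_selfHomology hA
    have e2 := Matrix.finrank_selfHomology hB
    have e3 := Matrix.finrank_selfHomology (M := G₁.parityCheckᵀ) hAT
    have e4 := Matrix.finrank_selfHomology (M := G₂.parityCheckᵀ) hBT
    rw [← hC₁.length, ← hC₂.length, ← hC₁T.length, ← hC₂T.length, ← hC₁.dimension,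
      ← hC₂.dimension, ← hC₁T.dimension, ← hC₂T.dimension]
    change (2 * (Module.finrank (ZMod 2) (LinearMap.ker G₁.parityCheck.mulVecLin) : ℤ) - _) *
      (2 * (Module.finrank (ZMod 2) (LinearMap.ker G₂.parityCheck.mulVecLin) : ℤ) - _) +
      (2 * (Module.finrank (ZMod 2) (LinearMap.ker G₁.parityCheckᵀ.mulVecLin) : ℤ) - _) *
      (2 * (Module.finrank (ZMod 2) (LinearMap.ker G₂.parityCheckᵀ.mulVecLin) : ℤ) - _) ≤ _
    rw [← e1, ← e2, ← e3, ← e4, hH]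
    exact_mod_cast h
  · refine le_iInf fun S => le_iInf fun E => le_iInf fun hE => le_iInf fun hdet => ?_
    by_contra! hlt
    refine hdet (isDetectable_cssCode_self (S := S) (fun c hc hcS => ?_) hE)
    have hcard : (hammingNorm c : ℕ∞) ≤ S.card := by
      refine Nat.cast_le.mpr (Finset.card_le_card fun i hi => ?_)
      by_contra hiS
      exact (Finset.mem_filter.mp hi).2 (hcS i hiS)
    have hlt' := hcard.trans_lt hlt
    rw [hH] at hc ⊢
    -- Elimination through `A` compares the weight only with `d₂` and `d₂T`, both at least the
    -- stated minimum.
    refine Matrix.mem_rowSpace_tannerProd_of_hammingNorm_lt hA hAT hc (fun z hz hz0 => ?_)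
      fun z hz hz0 => ?_
    · have h1 := minDistance_le_hammingNorm (C := G₂.code) hz hz0
      rw [hC₂.distance] at h1
      exact Nat.cast_lt.mp (hlt'.trans_le
        (((min_le_left _ _).trans (min_le_right _ _)).trans h1))
    · have h1 := minDistance_le_hammingNorm (C := G₂.transpose.code) hz hz0
      rw [hC₂T.distance] at h1
      exact Nat.cast_lt.mp (hlt'.trans_le
        (((min_le_right _ _).trans (min_le_right _ _)).trans h1))
  · rintro rfl rfl
    exact (hG₁.prod hG₁T hG₂ hG₂T).isExactQLRC ((hr₁.add_odd hr₂).add_one)
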